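/- For an $m\times m$ complex matrix $D$ let $\|D\|$ be its norm as an operator on $\ell_2^m$, let $\|D\|_2$ be its Hilbert--Schmidt norm, and put $[B,C]=BC-CB$. There are universal real constants $c$ and $c'$ such that the following hold. (Upper bound.) For every $m\ge 1$ and every $m\times m$ complex matrix $A$ with zero trace there are $m\times m$ complex matrices $B$ and $C$, with $B$ normal, such that $A=[B,C]$ and $$\|B\|\,\|C\|_2\le (c+\log m)^{1/2}\,\|A\|_2 .$$ (Lower bound.) For every $m\ge 1$ there is an $m\times m$ complex matrix $A$ with zero trace, nonzero if $m\ge 2$, such that all $m\times m$ complex matrices $B,C$ with $A=[B,C]$ satisfy $$\|B\|\,\|C\|_2\ge \tfrac12 (c'+\log m)^{1/2}\,\|A\|_2 ,$$ where $(c'+\log m)^{1/2}$ is read as $0$ if $c'+\log m<0$. In fact, for every rank-one orthogonal projection $P$ on $\ell_2^m$, the matrix $A=P-\frac1m I$ has zero trace and satisfies this lower bound with the same constant $c'$. -/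

import Mathlib

/-- The norm of a complex matrix as an operator on the Hilbert space `ℓ₂^m`. -/
noncomputable def opNorm {m : ℕ} (D : Matrix (Fin m) (Fin m) ℂ) : ℝ :=
  ‖Matrix.toEuclideanCLM (n := Fin m) (𝕜 := ℂ) D‖

/-- The Hilbert-Schmidt norm of a complex matrix. -/
noncomputable def hsNorm {m : ℕ} (D : Matrix (Fin m) (Fin m) ℂ) : ℝ :=
  Real.sqrt (∑ i, ∑ j, ‖D i j‖ ^ 2)

/-!
Write `‖·‖` for the operator norm and `‖·‖₂` for the Hilbert-Schmidt norm.

**Upper bound.** By the Toeplitz–Hausdorff theorem the mean of the diagonal entries of a matrix lies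
in its numerical range; applying this to one vector after another gives an orthonormal basis in
which a trace zero matrix `A` has zero diagonal (`exists_unitary_conj_diag_eq_zero`). If `B` is
diagonal in that basis with distinct entries `dᵢ`, then `A = [B, C]` for `Cᵢⱼ = Aᵢⱼ / (dᵢ - dⱼ)`.
Take for the `dᵢ` a permutation of `m` points of the square lattice in a disk of radius
`R = √(m / π) + 1`. Averaged over all permutations, `‖C‖₂²` equals `‖A‖₂²` times the mean of
`|z - w|⁻²` over pairs of distinct points (`exists_perm_sum_mul_le`), and for each `z` the sum over
`w` is at most the sum of `|w|⁻²` over the nonzero lattice points in a disk of radius about `2R`,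
which is `2π log R + O(1)` (`sum_latticeDisk_inv_sq_le`). As `R² = m / π + O(√m)`, the product
`R² ‖C‖₂²` is at most `(log m + O(1)) ‖A‖₂²` for some permutation.

**Lower bound.** Let `P - 1/m = [B, C]`, with `P` the projection onto the line of `e`. The spaces
`Vₙ` spanned by the vectors `Cⁱ Bʲ e` with `i + j < n` grow by at most `n + 1` dimensions from `Vₙ`
to `Vₙ₊₁`, and both `B` and `C` map `Vₙ` into `Vₙ₊₁`: a `B` can be moved past a `C` because
`BC - CB` maps every `y` to a combination of `e` and `y`. In an adapted orthonormal basis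
(`exists_orthonormalBasis_adapted`) both operators are therefore block Hessenberg. The trace of
`P_V (BC - CB) P_V` for `V = Vₙ₊₁` is `1 - dim V / m`; on the other hand only the blocks of `B` and
`C` between the levels `n` and `n + 1` contribute to it (`sum_filter_diag_commutator_eq`), so by
Cauchy–Schwarz its square is at most `2 (n + 1) ‖B‖²` times the square norm of those blocks of `C`.
These blocks are disjoint for different `n`, and summation over `n < √m` gives
`½ log m - 2 ≤ ∑ (1 - dim Vₙ₊₁ / m)² / (n + 1) ≤ 2 ‖B‖² ‖C‖₂²`.
-/

open scoped Matrix

/-! ### Norms and unitary conjugation -/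

section Norms
open scoped Matrix.Norms.L2Operator

variable {m : ℕ}

theorem hsNorm_nonneg (D : Matrix (Fin m) (Fin m) ℂ) : 0 ≤ hsNorm D := Real.sqrt_nonneg _

theorem opNorm_nonneg (D : Matrix (Fin m) (Fin m) ℂ) : 0 ≤ opNorm D := norm_nonneg _

theorem hsNorm_sq (D : Matrix (Fin m) (Fin m) ℂ) :
    hsNorm D ^ 2 = ∑ i, ∑ j, ‖D i j‖ ^ 2 :=
  Real.sq_sqrt (by positivity)

theorem opNorm_eq_norm (D : Matrix (Fin m) (Fin m) ℂ) : opNorm D = ‖D‖ := rfl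

theorem trace_conjTranspose_mul_self_eq (D : Matrix (Fin m) (Fin m) ℂ) :
    (Dᴴ * D).trace = ((hsNorm D ^ 2 : ℝ) : ℂ) := by
  rw [hsNorm_sq, Finset.sum_comm]
  simp only [Matrix.trace, Matrix.diag, Matrix.mul_apply, Matrix.conjTranspose_apply]
  push_cast
  refine Finset.sum_congr rfl fun i _ => Finset.sum_congr rfl fun j _ => ?_
  exact RCLike.conj_mul _

theorem hsNorm_unitary_conj {U : Matrix (Fin m) (Fin m) ℂ}
    (hU : U ∈ Matrix.unitaryGroup (Fin m) ℂ) (D : Matrix (Fin m) (Fin m) ℂ) :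
    hsNorm (star U * D * U) = hsNorm D := by
  have h1 : U * star U = 1 := Matrix.mem_unitaryGroup_iff.1 hU
  have h : hsNorm (star U * D * U) ^ 2 = hsNorm D ^ 2 := by
    have : ((hsNorm (star U * D * U) ^ 2 : ℝ) : ℂ) = ((hsNorm D ^ 2 : ℝ) : ℂ) := by
      rw [← trace_conjTranspose_mul_self_eq, ← trace_conjTranspose_mul_self_eq]
      have e : (star U * D * U)ᴴ * (star U * D * U) = star U * (Dᴴ * D * U) := by
        rw [← Matrix.star_eq_conjTranspose, star_mul, star_mul, star_star,
          ← Matrix.star_eq_conjTranspose]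
        calc star U * (star D * U) * (star U * D * U)
            = star U * (star D * (U * star U) * D * U) := by simp only [mul_assoc]
          _ = _ := by rw [h1, mul_one]
      rw [e, Matrix.trace_mul_comm, mul_assoc, h1, mul_one]
    exact_mod_cast this
  exact (pow_left_inj₀ (hsNorm_nonneg _) (hsNorm_nonneg _) two_ne_zero).1 h

theorem opNorm_unitary_conj {U : Matrix (Fin m) (Fin m) ℂ}
    (hU : U ∈ Matrix.unitaryGroup (Fin m) ℂ) (D : Matrix (Fin m) (Fin m) ℂ) :
    opNorm (star U * D * U) = opNorm D := by
  rw [opNorm_eq_norm, opNorm_eq_norm, CStarRing.norm_mul_mem_unitary _ hU,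
    CStarRing.norm_mem_unitary_mul _ (Unitary.star_mem hU)]

theorem opNorm_diagonal_le {d : Fin m → ℂ} {r : ℝ} (hr : 0 ≤ r) (h : ∀ i, ‖d i‖ ≤ r) :
    opNorm (Matrix.diagonal d) ≤ r := by
  rw [opNorm_eq_norm, Matrix.l2_opNorm_diagonal]
  exact (pi_norm_le_iff_of_nonneg hr).2 h

theorem sum_col_sq_le_opNorm_sq (B : Matrix (Fin m) (Fin m) ℂ) (j : Fin m) :
    ∑ i, ‖B i j‖ ^ 2 ≤ opNorm B ^ 2 := by
  have h := Matrix.l2_opNorm_mulVec B (EuclideanSpace.single j (1 : ℂ))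
  rw [PiLp.norm_single, norm_one, mul_one] at h
  have h2 := pow_le_pow_left₀ (norm_nonneg _) h 2
  rw [EuclideanSpace.norm_sq_eq] at h2
  simpa [opNorm_eq_norm] using h2

theorem sum_row_sq_le_opNorm_sq (B : Matrix (Fin m) (Fin m) ℂ) (i : Fin m) :
    ∑ j, ‖B i j‖ ^ 2 ≤ opNorm B ^ 2 := by
  have h := sum_col_sq_le_opNorm_sq Bᴴ i
  rw [opNorm_eq_norm, Matrix.l2_opNorm_conjTranspose, ← opNorm_eq_norm] at h
  simpa using h

end Norms

section BasisMatrix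

variable {m : ℕ}

/-- The unitary matrix whose `j`-th column is the `j`-th vector of an orthonormal basis. -/
noncomputable def basisMatrix (b : OrthonormalBasis (Fin m) ℂ (EuclideanSpace ℂ (Fin m))) :
    Matrix (Fin m) (Fin m) ℂ :=
  Matrix.of fun i j => b j i

theorem star_basisMatrix_mul_mul_apply
    (b : OrthonormalBasis (Fin m) ℂ (EuclideanSpace ℂ (Fin m)))
    (D : Matrix (Fin m) (Fin m) ℂ) (i j : Fin m) :
    (star (basisMatrix b) * D * basisMatrix b) i j =
      inner ℂ (b i) (Matrix.toEuclideanCLM (n := Fin m) (𝕜 := ℂ) D (b j)) := by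
  rw [mul_assoc, Matrix.mul_apply, PiLp.inner_apply]
  refine Finset.sum_congr rfl fun k _ => ?_
  rw [RCLike.inner_apply', Matrix.star_apply]
  congr 1

theorem basisMatrix_mem_unitaryGroup
    (b : OrthonormalBasis (Fin m) ℂ (EuclideanSpace ℂ (Fin m))) :
    basisMatrix b ∈ Matrix.unitaryGroup (Fin m) ℂ := by
  rw [Matrix.mem_unitaryGroup_iff']
  ext i j
  have h := star_basisMatrix_mul_mul_apply b 1 i j
  rw [mul_one, map_one] at h
  rw [h, one_apply_eq_self, orthonormal_iff_ite.1 b.orthonormal i j, Matrix.one_apply]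

theorem trace_star_mul_mul_of_mem_unitaryGroup {U : Matrix (Fin m) (Fin m) ℂ}
    (hU : U ∈ Matrix.unitaryGroup (Fin m) ℂ) (D : Matrix (Fin m) (Fin m) ℂ) :
    (star U * D * U).trace = D.trace := by
  rw [Matrix.trace_mul_comm, ← mul_assoc, Matrix.mem_unitaryGroup_iff.1 hU, one_mul]

end BasisMatrix

/-! ### The numerical range and bases with zero diagonal -/

section NumericalRange

variable {E : Type*} [NormedAddCommGroup E] [InnerProductSpace ℂ E]

theorem exists_norm_eq_one_im_mul_eq_zero (w : ℂ) : ∃ u : ℂ, ‖u‖ = 1 ∧ (u * w).im = 0 := by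
  by_cases hw : w = 0
  · exact ⟨1, by simp, by simp [hw]⟩
  · have hn : (‖w‖ : ℂ) ≠ 0 := by simpa using hw
    refine ⟨(starRingEnd ℂ) w / ‖w‖, by simp [hw], ?_⟩
    have : (starRingEnd ℂ) w / ‖w‖ * w = ((‖w‖ : ℝ) : ℂ) := by
      rw [div_mul_eq_mul_div, RCLike.conj_mul, div_eq_iff hn]; simp [sq]
    rw [this, Complex.ofReal_im]

/-- The normalized form of the Toeplitz–Hausdorff theorem: if the quadratic form of `T` takes the
values `0` and `1` at two unit vectors, it takes every value between them at a unit vector in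
their span. -/
theorem exists_inner_map_eq_of_zero_one (T : E →ₗ[ℂ] E) (S : Submodule ℂ E) {x y : E}
    (hx : x ∈ S) (hy : y ∈ S) (hx1 : ‖x‖ = 1) (hy1 : ‖y‖ = 1)
    (hTx : inner ℂ x (T x) = 0) (hTy : inner ℂ y (T y) = 1) {s : ℝ} (hs0 : 0 ≤ s) (hs1 : s ≤ 1) :
    ∃ z ∈ S, ‖z‖ = 1 ∧ inner ℂ z (T z) = (s : ℂ) := by
  -- A phase `u` on `x` makes the cross terms real, hence the form real along the whole segment.
  obtain ⟨u, hu1, hu⟩ := exists_norm_eq_one_im_mul_eq_zero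
    (inner ℂ y (T x) - (starRingEnd ℂ) (inner ℂ x (T y)))
  set z : ℝ → E := fun t => ((1 - t : ℝ) : ℂ) • u • x + (t : ℂ) • y with hz
  set κ : ℂ := (starRingEnd ℂ) u * inner ℂ x (T y) + u * inner ℂ y (T x) with hκ
  have hκim : κ.im = 0 := by
    have : κ.im = (u * (inner ℂ y (T x) - (starRingEnd ℂ) (inner ℂ x (T y)))).im := by
      simp only [hκ, Complex.add_im, Complex.mul_im, Complex.sub_im, Complex.sub_re,
        Complex.conj_re, Complex.conj_im]
      ring
    rw [this, hu]
  have hform : ∀ t : ℝ, inner ℂ (z t) (T (z t)) = ((t ^ 2 + t * (1 - t) * κ.re : ℝ) : ℂ) := by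
    intro t
    have hκre : κ = (κ.re : ℂ) := Complex.ext rfl (by simp [hκim])
    have : inner ℂ (z t) (T (z t)) = (t : ℂ) ^ 2 + t * (1 - t) * κ := by
      simp only [hz, map_add, map_smul, inner_add_left, inner_add_right, inner_smul_left,
        inner_smul_right, hTx, hTy, Complex.conj_ofReal, hκ]
      push_cast
      ring
    rw [this, hκre]; push_cast; simp
  have hcont : Continuous z := by
    simp only [hz]; fun_prop
  obtain ⟨t, -, ht⟩ : (0 : ℝ) ∈ (fun t : ℝ => t ^ 2 + t * (1 - t) * κ.re - s * ‖z t‖ ^ 2) ''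
      Set.Icc 0 1 := by
    refine intermediate_value_Icc zero_le_one (by fun_prop) ⟨?_, ?_⟩
    · simp only [hz]; simp [norm_smul, hu1, hx1, hs0]
    · simp only [hz]; simp [hy1, hs1]
  have hz0 : z t ≠ 0 := by
    intro h0
    have h1 : ((1 - t : ℝ) : ℂ) • u • x = -((t : ℂ) • y) := eq_neg_of_add_eq_zero_left h0
    have h2 : inner ℂ (((1 - t : ℝ) : ℂ) • u • x) (T (((1 - t : ℝ) : ℂ) • u • x)) = 0 := by
      simp only [map_smul, inner_smul_left, inner_smul_right, hTx, mul_zero]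
    rw [h1] at h2
    have h3 : t = 0 := by
      simp only [map_neg, map_smul, inner_neg_neg, inner_smul_left, inner_smul_right, hTy] at h2
      simpa using h2
    have h4 : u • x = 0 := by simpa [hz, h3] using h0
    have h5 : ‖u • x‖ = 1 := by rw [norm_smul, hu1, hx1, one_mul]
    rw [h4, norm_zero] at h5
    exact zero_ne_one h5
  have hn : ‖z t‖ ≠ 0 := norm_ne_zero_iff.2 hz0
  have hnc : (‖z t‖ : ℂ) ≠ 0 := by exact_mod_cast hn
  -- Both sides of the required identity are homogeneous, so `z t` can be normalized.
  refine ⟨((‖z t‖⁻¹ : ℝ) : ℂ) • z t, S.smul_mem _ (S.add_mem (S.smul_mem _ (S.smul_mem _ hx))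
    (S.smul_mem _ hy)), by simp [norm_smul, hn], ?_⟩
  rw [map_smul, inner_smul_left, inner_smul_right, hform, Complex.conj_ofReal, sub_eq_zero.1 ht]
  push_cast
  field_simp

/-- **Toeplitz–Hausdorff theorem**, for the part of the numerical range that comes from a
subspace `S`. -/
theorem convex_numericalRange (T : E →ₗ[ℂ] E) (S : Submodule ℂ E) :
    Convex ℝ {p : ℂ | ∃ x ∈ S, ‖x‖ = 1 ∧ inner ℂ x (T x) = p} := by
  rintro p ⟨x, hx, hx1, hxp⟩ q ⟨y, hy, hy1, hyq⟩ a s ha hs has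
  by_cases hpq : q - p = 0
  · refine ⟨x, hx, hx1, ?_⟩
    rw [sub_eq_zero.1 hpq, ← add_smul, has, one_smul, hxp]
  have hxx : inner ℂ x x = (1 : ℂ) := by rw [inner_self_eq_norm_sq_to_K, hx1]; simp
  have hyy : inner ℂ y y = (1 : ℂ) := by rw [inner_self_eq_norm_sq_to_K, hy1]; simp
  obtain ⟨z, hz, hz1, hzs⟩ := exists_inner_map_eq_of_zero_one
    ((q - p)⁻¹ • (T - p • LinearMap.id)) S hx hy hx1 hy1
    (by simp only [LinearMap.smul_apply, LinearMap.sub_apply, LinearMap.id_apply, inner_smul_right,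
          inner_sub_right, hxp, hxx, mul_one, sub_self, mul_zero])
    (by simp only [LinearMap.smul_apply, LinearMap.sub_apply, LinearMap.id_apply, inner_smul_right,
          inner_sub_right, hyq, hyy, mul_one, inv_mul_cancel₀ hpq]) hs (by linarith)
  have hzz : inner ℂ z z = (1 : ℂ) := by rw [inner_self_eq_norm_sq_to_K, hz1]; simp
  refine ⟨z, hz, hz1, ?_⟩
  have h : inner ℂ z (T z) - p = (q - p) * s := by
    rw [← hzs]
    simp only [LinearMap.smul_apply, LinearMap.sub_apply, LinearMap.id_apply, inner_smul_right,
      inner_sub_right, hzz]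
    field_simp
  have ha' : a = 1 - s := by linarith
  rw [eq_add_of_sub_eq h, ha']
  simp only [Complex.real_smul]
  push_cast
  ring

/-- The basis vectors with zero quadratic form are produced one at a time; the trace of the form is
the same in every orthonormal basis, so the remaining diagonal entries always sum to `0`. -/
theorem exists_orthonormalBasis_inner_map_eq_zero [FiniteDimensional ℂ E] {m : ℕ}
    (T : E →ₗ[ℂ] E) (b₀ : OrthonormalBasis (Fin m) ℂ E) (hT : ∑ i, inner ℂ (b₀ i) (T (b₀ i)) = 0) :
    ∃ b : OrthonormalBasis (Fin m) ℂ E, ∀ i, inner ℂ (b i) (T (b i)) = 0 := by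
  have key : ∀ k ≤ m, ∃ b : OrthonormalBasis (Fin m) ℂ E,
      ∀ i : Fin m, (i : ℕ) < k → inner ℂ (b i) (T (b i)) = 0 := by
    intro k
    induction k with
    | zero => exact fun _ => ⟨b₀, fun i hi => absurd hi (by omega)⟩
    | succ k ih =>
      intro hk
      obtain ⟨b, hb⟩ := ih (by omega)
      set J : Finset (Fin m) := Finset.univ.filter fun i => k ≤ (i : ℕ) with hJ
      have hsum : ∑ i ∈ J, inner ℂ (b i) (T (b i)) = 0 := by
        have h1 : ∑ i, inner ℂ (b i) (T (b i)) = 0 := by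
          rw [← LinearMap.trace_eq_sum_inner, LinearMap.trace_eq_sum_inner T b₀, hT]
        rw [← h1]
        refine Finset.sum_subset (Finset.subset_univ _) fun i _ hi => hb i ?_
        simpa [hJ] using hi
      -- The mean of the remaining diagonal entries is `0`, so `0` is in the numerical range.
      set S : Submodule ℂ E := Submodule.span ℂ (b '' (J : Set (Fin m))) with hS
      have hJne : (J.card : ℝ) ≠ 0 := by
        have : (⟨k, by omega⟩ : Fin m) ∈ J := by simp [hJ]
        exact_mod_cast (Finset.card_pos.2 ⟨_, this⟩).ne'
      obtain ⟨x, hxS, hx1, hx0⟩ : (0 : ℂ) ∈ {p : ℂ | ∃ x ∈ S, ‖x‖ = 1 ∧ inner ℂ x (T x) = p} := by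
        have h := (convex_numericalRange T S).sum_mem (t := J) (w := fun _ => (J.card : ℝ)⁻¹)
          (z := fun i => inner ℂ (b i) (T (b i))) (fun _ _ => by positivity)
          (by rw [Finset.sum_const, nsmul_eq_mul, mul_inv_cancel₀ hJne])
          (fun i hi => ⟨b i, Submodule.subset_span ⟨i, hi, rfl⟩, b.orthonormal.1 i, rfl⟩)
        rwa [← Finset.smul_sum, hsum, smul_zero] at h
      have hperp : ∀ i : Fin m, (i : ℕ) < k → inner ℂ (b i) x = 0 := by
        intro i hi
        refine Submodule.span_induction (p := fun x _ => inner ℂ (b i) x = 0) ?_ (by simp)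
          (fun a c _ _ ha hc => by rw [inner_add_right, ha, hc, add_zero])
          (fun c a _ ha => by rw [inner_smul_right, ha, mul_zero]) hxS
        rintro _ ⟨j, hj, rfl⟩
        have hj' : k ≤ (j : ℕ) := by simpa [hJ] using hj
        exact b.orthonormal.2 (by rintro rfl; omega)
      set v : Fin m → E := fun i => if (i : ℕ) < k then b i else x with hv
      have hvo : Orthonormal ℂ (Set.domRestrict {i : Fin m | (i : ℕ) < k + 1} v) := by
        constructor
        · rintro ⟨i, hi⟩
          by_cases h : (i : ℕ) < k
          · simp [hv, Set.domRestrict, h]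
          · simp [hv, Set.domRestrict, h, hx1]
        · rintro ⟨i, hi⟩ ⟨j, hj⟩ hij
          have hij' : i ≠ j := fun h => hij (Subtype.ext h)
          have hi' : (i : ℕ) < k + 1 := hi
          have hj' : (j : ℕ) < k + 1 := hj
          have hval : (i : ℕ) ≠ j := fun h => hij' (Fin.ext h)
          by_cases h : (i : ℕ) < k <;> by_cases h' : (j : ℕ) < k
          · simpa [hv, Set.domRestrict, h, h'] using b.orthonormal.2 hij'
          · simpa [hv, Set.domRestrict, h, h'] using hperp i h
          · simpa [hv, Set.domRestrict, h, h'] using inner_eq_zero_symm.1 (hperp j h')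
          · omega
      obtain ⟨b', hb'⟩ := hvo.exists_orthonormalBasis_extension_of_card_eq
        (by simpa using Module.finrank_eq_card_basis b.toBasis)
      refine ⟨b', fun i hi => ?_⟩
      rw [hb' i hi]
      by_cases h : (i : ℕ) < k
      · simpa [hv, h] using hb i h
      · simpa [hv, h] using hx0
  obtain ⟨b, hb⟩ := key m le_rfl
  exact ⟨b, fun i => hb i i.2⟩

end NumericalRange

theorem exists_unitary_conj_diag_eq_zero {m : ℕ} (A : Matrix (Fin m) (Fin m) ℂ)
    (hA : A.trace = 0) :
    ∃ U ∈ Matrix.unitaryGroup (Fin m) ℂ, ∀ i, (star U * A * U) i i = 0 := by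
  set b₀ := EuclideanSpace.basisFun (Fin m) ℂ
  set T := (Matrix.toEuclideanCLM (n := Fin m) (𝕜 := ℂ) A).toLinearMap with hT
  have hentry : ∀ (b : OrthonormalBasis (Fin m) ℂ (EuclideanSpace ℂ (Fin m))) (i : Fin m),
      (star (basisMatrix b) * A * basisMatrix b) i i = inner ℂ (b i) (T (b i)) :=
    fun b i => star_basisMatrix_mul_mul_apply b A i i
  have h0 : ∑ i, inner ℂ (b₀ i) (T (b₀ i)) = 0 := by
    rw [← hA, ← trace_star_mul_mul_of_mem_unitaryGroup (basisMatrix_mem_unitaryGroup b₀) A]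
    exact Finset.sum_congr rfl fun i _ => (hentry b₀ i).symm
  obtain ⟨b, hb⟩ := exists_orthonormalBasis_inner_map_eq_zero T b₀ h0
  exact ⟨basisMatrix b, basisMatrix_mem_unitaryGroup b, fun i => (hentry b i).trans (hb i)⟩

/-! ### Lattice points in a disk -/

section LatticePoints

open MeasureTheory

/-- The point of the square lattice `ℤ + iℤ` with given integer coordinates. -/
def latticePoint (p : ℤ × ℤ) : ℂ := ⟨p.1, p.2⟩

theorem latticePoint_sub (p q : ℤ × ℤ) :
    latticePoint (p - q) = latticePoint p - latticePoint q := by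
  apply Complex.ext <;> simp [latticePoint]

theorem latticePoint_injective : Function.Injective latticePoint := by
  intro p q h
  have h1 := congrArg Complex.re h
  have h2 := congrArg Complex.im h
  simp only [latticePoint, Int.cast_inj] at h1 h2
  exact Prod.ext h1 h2

/-- The lattice points in the closed disk of radius `R` around the origin. The box only serves to
make the set finite; see `mem_latticeDisk`. -/
noncomputable def latticeDisk (R : ℝ) : Finset (ℤ × ℤ) :=
  (Finset.Icc (-⌊R⌋) ⌊R⌋ ×ˢ Finset.Icc (-⌊R⌋) ⌊R⌋).filter fun p => ‖latticePoint p‖ ≤ R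

theorem mem_latticeDisk {R : ℝ} {p : ℤ × ℤ} : p ∈ latticeDisk R ↔ ‖latticePoint p‖ ≤ R := by
  rw [latticeDisk, Finset.mem_filter, and_iff_right_iff_imp]
  intro h
  have h1 := abs_le.1 ((Complex.abs_re_le_norm (latticePoint p)).trans h)
  have h2 := abs_le.1 ((Complex.abs_im_le_norm (latticePoint p)).trans h)
  simp only [latticePoint] at h1 h2
  simp only [Finset.mem_product, Finset.mem_Icc, Int.le_floor, neg_le (a := ⌊R⌋)]
  push_cast
  exact ⟨⟨by linarith, h1.2⟩, by linarith, h2.2⟩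

/-- The half-open unit square centred at a lattice point; these squares tile the plane. -/
def latticeCell (p : ℤ × ℤ) : Set ℂ :=
  Set.Ico ((p.1 : ℝ) - 1 / 2) (p.1 + 1 / 2) ×ℂ Set.Ico ((p.2 : ℝ) - 1 / 2) (p.2 + 1 / 2)

theorem measurableSet_latticeCell (p : ℤ × ℤ) : MeasurableSet (latticeCell p) :=
  (measurableSet_Ico.preimage Complex.measurable_re).inter
    (measurableSet_Ico.preimage Complex.measurable_im)

theorem volume_latticeCell (p : ℤ × ℤ) : volume (latticeCell p) = 1 := by
  have h : latticeCell p = Complex.measurableEquivRealProd ⁻¹'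
      (Set.Ico ((p.1 : ℝ) - 1 / 2) (p.1 + 1 / 2) ×ˢ
        Set.Ico ((p.2 : ℝ) - 1 / 2) (p.2 + 1 / 2)) := by
    ext z
    simp [latticeCell, Complex.mem_reProdIm, Complex.measurableEquivRealProd]
  rw [h, Complex.volume_preserving_equiv_real_prod.measure_preimage
    (measurableSet_Ico.prod measurableSet_Ico).nullMeasurableSet, Measure.volume_eq_prod,
    Measure.prod_prod, Real.volume_Ico, Real.volume_Ico]
  norm_num

theorem norm_sub_latticePoint_le {p : ℤ × ℤ} {z : ℂ} (hz : z ∈ latticeCell p) :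
    ‖z - latticePoint p‖ ≤ 1 := by
  obtain ⟨⟨h1, h2⟩, h3, h4⟩ := hz
  refine (Complex.norm_le_abs_re_add_abs_im _).trans ?_
  have e1 : |(z - latticePoint p).re| ≤ 1 / 2 := by
    simp only [Complex.sub_re, latticePoint]; exact abs_le.2 ⟨by linarith, by linarith⟩
  have e2 : |(z - latticePoint p).im| ≤ 1 / 2 := by
    simp only [Complex.sub_im, latticePoint]; exact abs_le.2 ⟨by linarith, by linarith⟩
  linarith

theorem mem_latticeCell_iff {p : ℤ × ℤ} {z : ℂ} :
    z ∈ latticeCell p ↔ p = (⌊z.re + 1 / 2⌋, ⌊z.im + 1 / 2⌋) := by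
  rw [Prod.ext_iff, eq_comm, Int.floor_eq_iff, eq_comm, Int.floor_eq_iff, latticeCell,
    Complex.mem_reProdIm, Set.mem_Ico, Set.mem_Ico]
  constructor
  · rintro ⟨⟨h1, h2⟩, h3, h4⟩
    exact ⟨⟨by linarith, by linarith⟩, by linarith, by linarith⟩
  · rintro ⟨⟨h1, h2⟩, h3, h4⟩
    exact ⟨⟨by linarith, by linarith⟩, by linarith, by linarith⟩

theorem volume_biUnion_latticeCell (F : Finset (ℤ × ℤ)) :
    volume (⋃ p ∈ F, latticeCell p) = F.card := by
  rw [measure_biUnion_finset _ fun p _ => measurableSet_latticeCell p]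
  · simp [volume_latticeCell]
  · intro p _ q _ hpq
    refine Set.disjoint_left.2 fun z hp hq => hpq ?_
    rw [mem_latticeCell_iff.1 hp, mem_latticeCell_iff.1 hq]

theorem volume_closedBall_eq_ofReal {r : ℝ} (hr : 0 ≤ r) :
    volume (Metric.closedBall (0 : ℂ) r) = ENNReal.ofReal (Real.pi * r ^ 2) := by
  rw [Complex.volume_closedBall, ENNReal.ofReal_mul Real.pi_pos.le, ENNReal.ofReal_pow hr, mul_comm]
  congr 1
  rw [← NNReal.coe_real_pi, ENNReal.ofReal_coe_nnreal]

theorem card_latticeDisk_le {R : ℝ} (hR : 0 ≤ R) :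
    ((latticeDisk R).card : ℝ) ≤ Real.pi * (R + 1) ^ 2 := by
  have h : volume (⋃ p ∈ latticeDisk R, latticeCell p) ≤
      volume (Metric.closedBall (0 : ℂ) (R + 1)) := by
    refine measure_mono (Set.iUnion₂_subset fun p hp z hz => ?_)
    rw [mem_closedBall_zero_iff]
    have h1 := norm_add_le (z - latticePoint p) (latticePoint p)
    rw [sub_add_cancel] at h1
    linarith [norm_sub_latticePoint_le hz, mem_latticeDisk.1 hp]
  rw [volume_biUnion_latticeCell, volume_closedBall_eq_ofReal (by positivity)] at h
  rw [← ENNReal.ofReal_natCast] at h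
  exact (ENNReal.ofReal_le_ofReal_iff (by positivity)).1 h

theorem le_card_latticeDisk {R : ℝ} (hR : 0 ≤ R) :
    Real.pi * R ^ 2 ≤ ((latticeDisk (R + 1)).card : ℝ) := by
  have h : volume (Metric.closedBall (0 : ℂ) R) ≤
      volume (⋃ p ∈ latticeDisk (R + 1), latticeCell p) := by
    refine measure_mono fun z hz => ?_
    rw [mem_closedBall_zero_iff] at hz
    have hzc : z ∈ latticeCell (⌊z.re + 1 / 2⌋, ⌊z.im + 1 / 2⌋) := mem_latticeCell_iff.2 rfl
    refine Set.mem_iUnion₂.2 ⟨_, mem_latticeDisk.2 ?_, hzc⟩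
    have h1 := norm_sub_latticePoint_le hzc
    rw [norm_sub_rev] at h1
    have h2 := norm_add_le (latticePoint (⌊z.re + 1 / 2⌋, ⌊z.im + 1 / 2⌋) - z) z
    rw [sub_add_cancel] at h2
    linarith
  rw [volume_biUnion_latticeCell, volume_closedBall_eq_ofReal hR, ← ENNReal.ofReal_natCast] at h
  exact (ENNReal.ofReal_le_ofReal_iff (by positivity)).1 h

theorem one_le_norm_latticePoint {p : ℤ × ℤ} (hp : p ≠ 0) : 1 ≤ ‖latticePoint p‖ := by
  by_contra! h
  have h1 := (Complex.abs_re_le_norm (latticePoint p)).trans_lt h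
  have h2 := (Complex.abs_im_le_norm (latticePoint p)).trans_lt h
  simp only [latticePoint] at h1 h2
  norm_cast at h1 h2
  exact hp (Prod.ext (Int.abs_lt_one_iff.1 h1) (Int.abs_lt_one_iff.1 h2))

/-- The telescoping form of `n⁻²` used for summation by parts. -/
theorem inv_sq_eq_add_sum_Ico {n M : ℕ} (h : n ≤ M + 1) :
    ((n : ℝ) ^ 2)⁻¹ = (((M : ℝ) + 1) ^ 2)⁻¹ +
      ∑ k ∈ Finset.Ico n (M + 1), (((k : ℝ) ^ 2)⁻¹ - (((k : ℝ) + 1) ^ 2)⁻¹) := by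
  have := Finset.sum_Ico_sub (fun k : ℕ => -((k : ℝ) ^ 2)⁻¹) h
  push_cast at this
  rw [show (∑ k ∈ Finset.Ico n (M + 1), (((k : ℝ) ^ 2)⁻¹ - (((k : ℝ) + 1) ^ 2)⁻¹)) =
    ∑ k ∈ Finset.Ico n (M + 1), (-(((k : ℝ) + 1) ^ 2)⁻¹ - -((k : ℝ) ^ 2)⁻¹) from
    Finset.sum_congr rfl fun _ _ => by ring, this]
  ring

theorem inv_sq_sub_inv_sq_nonneg {k : ℕ} (hk : 1 ≤ k) :
    0 ≤ ((k : ℝ) ^ 2)⁻¹ - (((k : ℝ) + 1) ^ 2)⁻¹ := by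
  have : (1 : ℝ) ≤ k := by exact_mod_cast hk
  rw [sub_nonneg]
  gcongr
  linarith

theorem sum_Icc_inv_sq_le_two (M : ℕ) : ∑ k ∈ Finset.Icc 1 M, ((k : ℝ) ^ 2)⁻¹ ≤ 2 := by
  have h : Finset.Icc 1 M = Finset.Ioo 0 (M + 1) := by
    ext k; simp only [Finset.mem_Icc, Finset.mem_Ioo]; omega
  rw [h]
  simpa using sum_Ioo_inv_sq_le (α := ℝ) 0 (M + 1)

theorem inv_sq_sub_inv_sq_mul_le {k : ℕ} (hk : 1 ≤ k) :
    (((k : ℝ) ^ 2)⁻¹ - (((k : ℝ) + 1) ^ 2)⁻¹) * ((k : ℝ) + 2) ^ 2 ≤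
      2 * (k : ℝ)⁻¹ + 5 * ((k : ℝ) ^ 2)⁻¹ := by
  have : (1 : ℝ) ≤ k := by exact_mod_cast hk
  rw [← sub_nonneg]
  have e : 2 * (k : ℝ)⁻¹ + 5 * ((k : ℝ) ^ 2)⁻¹ -
      (((k : ℝ) ^ 2)⁻¹ - (((k : ℝ) + 1) ^ 2)⁻¹) * ((k : ℝ) + 2) ^ 2 =
      1 / ((k : ℝ) ^ 2 * ((k : ℝ) + 1) ^ 2) := by
    field_simp
    ring
  rw [e]
  positivity

/-- Summation by parts against the lattice point count `N(k + 1) ≤ π (k + 2)²`. -/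
theorem sum_latticeDisk_inv_sq_le {M : ℕ} (hM : 1 ≤ M) :
    ∑ p ∈ latticeDisk M, (‖latticePoint p‖ ^ 2)⁻¹ ≤ 2 * Real.pi * Real.log M + 13 * Real.pi := by
  set d : ℕ → ℝ := fun k => ((k : ℝ) ^ 2)⁻¹ - (((k : ℝ) + 1) ^ 2)⁻¹ with hd
  have hpt : ∀ p ∈ latticeDisk M, (‖latticePoint p‖ ^ 2)⁻¹ ≤ (((M : ℝ) + 1) ^ 2)⁻¹ +
      ∑ k ∈ Finset.Icc 1 M, if ‖latticePoint p‖ ≤ (k : ℝ) + 1 then d k else 0 := by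
    intro p hp
    rw [mem_latticeDisk] at hp
    have hnn : 0 ≤ ∑ k ∈ Finset.Icc 1 M, if ‖latticePoint p‖ ≤ (k : ℝ) + 1 then d k else 0 := by
      refine Finset.sum_nonneg fun k hk => ?_
      split_ifs
      · exact inv_sq_sub_inv_sq_nonneg (Finset.mem_Icc.1 hk).1
      · exact le_rfl
    -- The origin contributes `0⁻¹ = 0` to the sum.
    by_cases hp0 : p = 0
    · have : latticePoint p = 0 := by rw [hp0]; apply Complex.ext <;> simp [latticePoint]
      rw [this, norm_zero] at hnn ⊢
      rw [zero_pow two_ne_zero, inv_zero]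
      positivity
    have h1 := one_le_norm_latticePoint hp0
    -- `‖p‖⁻² ≤ n⁻²` with `n = ⌊‖p‖⌋`, and every `k ≥ n` satisfies `‖p‖ ≤ k + 1`.
    set n := ⌊‖latticePoint p‖⌋₊ with hn
    have hn1 : 1 ≤ n := Nat.le_floor (by exact_mod_cast h1)
    have hn1' : (1 : ℝ) ≤ n := by exact_mod_cast hn1
    have hnM : n ≤ M := Nat.floor_le_of_le hp
    have hnle : (n : ℝ) ≤ ‖latticePoint p‖ := Nat.floor_le (norm_nonneg _)
    have hlt : ‖latticePoint p‖ < n + 1 := Nat.lt_floor_add_one _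
    calc (‖latticePoint p‖ ^ 2)⁻¹ ≤ ((n : ℝ) ^ 2)⁻¹ := by gcongr
      _ = (((M : ℝ) + 1) ^ 2)⁻¹ + ∑ k ∈ Finset.Ico n (M + 1), d k :=
        inv_sq_eq_add_sum_Ico (by omega)
      _ = (((M : ℝ) + 1) ^ 2)⁻¹ + ∑ k ∈ Finset.Ico n (M + 1),
            if ‖latticePoint p‖ ≤ (k : ℝ) + 1 then d k else 0 := by
        congr 1
        refine Finset.sum_congr rfl fun k hk => (if_pos ?_).symm
        have : (n : ℝ) ≤ k := by exact_mod_cast (Finset.mem_Ico.1 hk).1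
        linarith
      _ ≤ _ := by
        refine add_le_add_right (Finset.sum_le_sum_of_subset_of_nonneg (fun k hk => ?_)
          fun k hk _ => ?_) _
        · simp only [Finset.mem_Ico, Finset.mem_Icc] at hk ⊢; omega
        · split_ifs
          · exact inv_sq_sub_inv_sq_nonneg (Finset.mem_Icc.1 hk).1
          · exact le_rfl
  have hcount : ∀ k ∈ Finset.Icc 1 M,
      (∑ p ∈ latticeDisk M, if ‖latticePoint p‖ ≤ (k : ℝ) + 1 then d k else 0) ≤
        Real.pi * (2 * (k : ℝ)⁻¹ + 5 * ((k : ℝ) ^ 2)⁻¹) := by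
    intro k hk
    have hk1 := (Finset.mem_Icc.1 hk).1
    have hsub : (latticeDisk M).filter (fun p => ‖latticePoint p‖ ≤ (k : ℝ) + 1) ⊆
        latticeDisk ((k : ℝ) + 1) := fun p hp => mem_latticeDisk.2 (Finset.mem_filter.1 hp).2
    have hcard : (((latticeDisk M).filter (fun p => ‖latticePoint p‖ ≤ (k : ℝ) + 1)).card : ℝ) ≤
        Real.pi * ((k : ℝ) + 2) ^ 2 := by
      refine (Nat.cast_le.2 (Finset.card_le_card hsub)).trans ?_
      refine (card_latticeDisk_le (by positivity)).trans_eq ?_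
      ring
    rw [← Finset.sum_filter, Finset.sum_const, nsmul_eq_mul]
    calc _ ≤ Real.pi * ((k : ℝ) + 2) ^ 2 * d k :=
          mul_le_mul_of_nonneg_right hcard (inv_sq_sub_inv_sq_nonneg hk1)
      _ = Real.pi * (d k * ((k : ℝ) + 2) ^ 2) := by ring
      _ ≤ _ := mul_le_mul_of_nonneg_left (inv_sq_sub_inv_sq_mul_le hk1) Real.pi_pos.le
  have hharm : ∑ k ∈ Finset.Icc 1 M, (k : ℝ)⁻¹ ≤ 1 + Real.log M := by
    have := harmonic_le_one_add_log M
    rw [harmonic_eq_sum_Icc] at this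
    push_cast at this
    exact this
  calc ∑ p ∈ latticeDisk M, (‖latticePoint p‖ ^ 2)⁻¹
      ≤ ∑ p ∈ latticeDisk M, ((((M : ℝ) + 1) ^ 2)⁻¹ +
          ∑ k ∈ Finset.Icc 1 M, if ‖latticePoint p‖ ≤ (k : ℝ) + 1 then d k else 0) :=
        Finset.sum_le_sum hpt
    _ = (latticeDisk M).card * (((M : ℝ) + 1) ^ 2)⁻¹ + ∑ k ∈ Finset.Icc 1 M,
          ∑ p ∈ latticeDisk M, if ‖latticePoint p‖ ≤ (k : ℝ) + 1 then d k else 0 := by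
        rw [Finset.sum_add_distrib, Finset.sum_const, nsmul_eq_mul, Finset.sum_comm]
    _ ≤ Real.pi * ((M : ℝ) + 1) ^ 2 * (((M : ℝ) + 1) ^ 2)⁻¹ +
          ∑ k ∈ Finset.Icc 1 M, Real.pi * (2 * (k : ℝ)⁻¹ + 5 * ((k : ℝ) ^ 2)⁻¹) := by
        gcongr with k hk
        · exact card_latticeDisk_le (by positivity)
        · exact hcount k hk
    _ = Real.pi + Real.pi * (2 * ∑ k ∈ Finset.Icc 1 M, (k : ℝ)⁻¹ +
          5 * ∑ k ∈ Finset.Icc 1 M, ((k : ℝ) ^ 2)⁻¹) := by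
        rw [← Finset.mul_sum, Finset.sum_add_distrib, ← Finset.mul_sum, ← Finset.mul_sum,
          mul_inv_cancel_right₀ (by positivity)]
    _ ≤ Real.pi + Real.pi * (2 * (1 + Real.log M) + 5 * 2) := by
        gcongr
        exact sum_Icc_inv_sq_le_two M
    _ = _ := by ring

/-- The differences of `m` lattice points in a disk of radius `R` are distinct lattice points in a
disk of radius `2 * R`. The diagonal term of the sum is `0⁻¹ = 0`. -/
theorem exists_points_of_le_card {m M : ℕ} {R : ℝ} (hM : 1 ≤ M) (hRM : 2 * R ≤ M)
    (hcard : m ≤ (latticeDisk R).card) :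
    ∃ β : Fin m → ℂ, Function.Injective β ∧ (∀ i, ‖β i‖ ≤ R) ∧
      ∀ i, ∑ j, (‖β i - β j‖ ^ 2)⁻¹ ≤ 2 * Real.pi * Real.log M + 13 * Real.pi := by
  obtain ⟨F, hF, hFc⟩ := Finset.exists_subset_card_eq hcard
  set e := (F.equivFinOfCardEq hFc).symm
  have hmem : ∀ i, ‖latticePoint (e i)‖ ≤ R := fun i => mem_latticeDisk.1 (hF (e i).2)
  refine ⟨fun i => latticePoint (e i), latticePoint_injective.comp
    (Subtype.val_injective.comp e.injective), hmem, fun i => ?_⟩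
  refine le_trans ?_ (sum_latticeDisk_inv_sq_le hM)
  have hinj : Function.Injective fun j => (e i : ℤ × ℤ) - e j := fun j k h =>
    e.injective (Subtype.ext (sub_right_injective h))
  calc ∑ j, (‖latticePoint (e i) - latticePoint (e j)‖ ^ 2)⁻¹
      = ∑ p ∈ Finset.univ.image fun j => (e i : ℤ × ℤ) - e j, (‖latticePoint p‖ ^ 2)⁻¹ := by
        rw [Finset.sum_image fun _ _ _ _ h => hinj h]
        simp only [latticePoint_sub]
    _ ≤ _ := by
        refine Finset.sum_le_sum_of_subset_of_nonneg (fun p hp => ?_) fun _ _ _ => by positivity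
        obtain ⟨j, -, rfl⟩ := Finset.mem_image.1 hp
        rw [mem_latticeDisk, latticePoint_sub]
        refine (norm_sub_le _ _).trans ?_
        linarith [hmem i, hmem j]

/-- The numerical estimate `(s + 1)² (2π log M + O(1)) ≤ (m - 1) (log m + O(1))`, where
`s = √(m / π)` and `M` is about `2 (s + 1)`. The error terms are of order `√m log m`, and
`log m ≤ 2 √m` bounds them by a multiple of `m`. -/
theorem radius_sq_mul_log_bound {m M : ℕ} (hm : 2 ≤ m) {s : ℝ} (hs0 : 0 ≤ s)
    (hs : Real.pi * s ^ 2 = m) (hM1 : 1 ≤ M) (hM : (M : ℝ) ≤ 2 * (s + 1) + 1) :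
    (s + 1) ^ 2 * (2 * Real.pi * Real.log M + 13 * Real.pi) ≤
      (m - 1) * (500 + Real.log m) := by
  have hm' : (2 : ℝ) ≤ m := by exact_mod_cast hm
  have hπ := Real.pi_gt_three
  have hπ4 := Real.pi_le_four
  set r : ℝ := Real.sqrt m with hr
  have hr2 : r ^ 2 = m := Real.sq_sqrt (by positivity)
  have hr1 : 1 ≤ r := Real.one_le_sqrt.2 (by linarith)
  have hrpos : 0 < r := by linarith
  have hlogr : Real.log m = 2 * Real.log r := by rw [← hr2, Real.log_pow]; norm_num
  have hlog0 : 0 ≤ Real.log r := Real.log_nonneg hr1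
  have hlogle : Real.log r ≤ r - 1 := Real.log_le_sub_one_of_pos hrpos
  have hsr : s ≤ r := by
    refine Real.le_sqrt_of_sq_le ?_
    nlinarith [sq_nonneg s]
  have hMr : (M : ℝ) ≤ 5 * r := by linarith
  have hlogM : Real.log M ≤ 2 + Real.log r := by
    have h5 : Real.log 5 ≤ 2 := by
      rw [Real.log_le_iff_le_exp (by norm_num)]
      have := Real.exp_one_gt_d9
      have h2 : Real.exp 2 = Real.exp 1 * Real.exp 1 := by rw [← Real.exp_add]; norm_num
      rw [h2]
      nlinarith
    have hMpos : (0 : ℝ) < M := by exact_mod_cast hM1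
    calc Real.log M ≤ Real.log (5 * r) := Real.log_le_log hMpos hMr
      _ = Real.log 5 + Real.log r := Real.log_mul (by norm_num) hrpos.ne'
      _ ≤ _ := by linarith
  have hx : Real.pi * (s + 1) ^ 2 ≤ (m - 1) + 13 * r := by nlinarith
  calc (s + 1) ^ 2 * (2 * Real.pi * Real.log M + 13 * Real.pi)
      ≤ (s + 1) ^ 2 * (2 * Real.pi * (2 + Real.log r) + 13 * Real.pi) := by gcongr
    _ = Real.pi * (s + 1) ^ 2 * (Real.log m + 17) := by rw [hlogr]; ring
    _ ≤ ((m - 1) + 13 * r) * (Real.log m + 17) := by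
        have : 0 ≤ Real.log m + 17 := by linarith
        gcongr
    _ ≤ _ := by
        rw [hlogr]
        nlinarith

/-- There are `m` points whose mean inverse square distance, measured relative to the radius of a
disk that contains them, is at most `log m + O(1)`. -/
theorem exists_well_spaced_points {m : ℕ} (hm : 2 ≤ m) :
    ∃ (R : ℝ) (β : Fin m → ℂ), 0 ≤ R ∧ Function.Injective β ∧ (∀ i, ‖β i‖ ≤ R) ∧
      R ^ 2 * ∑ i, ∑ j, (‖β i - β j‖ ^ 2)⁻¹ ≤ m * (m - 1) * (500 + Real.log m) := by
  set s : ℝ := Real.sqrt (m / Real.pi) with hs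
  have hs0 : 0 ≤ s := Real.sqrt_nonneg _
  have hs2 : Real.pi * s ^ 2 = m := by
    rw [hs, Real.sq_sqrt (div_nonneg (Nat.cast_nonneg _) Real.pi_pos.le),
      mul_div_cancel₀ _ Real.pi_ne_zero]
  have hM1 : 1 ≤ ⌈2 * (s + 1)⌉₊ := Nat.one_le_ceil_iff.2 (by positivity)
  have hcard : m ≤ (latticeDisk (s + 1)).card := by
    have := le_card_latticeDisk hs0
    rw [hs2] at this
    exact_mod_cast this
  obtain ⟨β, hβ, hβR, hβs⟩ := exists_points_of_le_card hM1 (Nat.le_ceil _) hcard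
  refine ⟨s + 1, β, by positivity, hβ, hβR, ?_⟩
  calc (s + 1) ^ 2 * ∑ i, ∑ j, (‖β i - β j‖ ^ 2)⁻¹
      ≤ (s + 1) ^ 2 * ∑ _i : Fin m, (2 * Real.pi * Real.log ⌈2 * (s + 1)⌉₊ + 13 * Real.pi) := by
        gcongr with i; exact hβs i
    _ = m * ((s + 1) ^ 2 * (2 * Real.pi * Real.log ⌈2 * (s + 1)⌉₊ + 13 * Real.pi)) := by
        rw [Finset.sum_const, Finset.card_univ, Fintype.card_fin, nsmul_eq_mul]; ring
    _ ≤ m * ((m - 1) * (500 + Real.log m)) := by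
        exact mul_le_mul_of_nonneg_left (radius_sq_mul_log_bound hm hs0 hs2 hM1
          (Nat.ceil_lt_add_one (by positivity)).le) (Nat.cast_nonneg m)
    _ = _ := by ring

end LatticePoints

/-! ### Averaging over permutations -/

section Averaging

variable {ι : Type*} [DecidableEq ι]

theorem exists_perm_apply_eq_and {i j k l : ι} (hij : i ≠ j) (hkl : k ≠ l) :
    ∃ τ : Equiv.Perm ι, τ i = k ∧ τ j = l := by
  have hj : Equiv.swap i k j ≠ k := by
    intro h
    refine hij ((Equiv.swap i k).injective ?_)
    rw [h, Equiv.swap_apply_left]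
  refine ⟨Equiv.swap (Equiv.swap i k j) l * Equiv.swap i k, ?_, ?_⟩
  · rw [Equiv.Perm.mul_apply, Equiv.swap_apply_left, Equiv.swap_apply_of_ne_of_ne hj.symm hkl]
  · rw [Equiv.Perm.mul_apply, Equiv.swap_apply_left]

variable [Fintype ι]

/-- Since the symmetric group is doubly transitive, the average of `g (σ i) (σ j)` over all
permutations `σ` is the same for all pairs `i ≠ j`. -/
theorem card_mul_sum_perm_eq (g : ι → ι → ℝ) (hg : ∀ i, g i i = 0) {i j : ι} (hij : i ≠ j) :
    (Fintype.card ι : ℝ) * (Fintype.card ι - 1) * ∑ σ : Equiv.Perm ι, g (σ i) (σ j) =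
      ∑ _σ : Equiv.Perm ι, ∑ k, ∑ l, g k l := by
  have hT : ∀ k l, ∑ σ : Equiv.Perm ι, g (σ k) (σ l) =
      (∑ σ : Equiv.Perm ι, g (σ i) (σ j)) - if k = l then ∑ σ : Equiv.Perm ι, g (σ i) (σ j)
        else 0 := by
    intro k l
    split_ifs with hkl
    · simp [hkl, hg]
    · obtain ⟨τ, rfl, rfl⟩ := exists_perm_apply_eq_and hij hkl
      rw [sub_zero]
      exact Equiv.sum_comp (Equiv.mulRight τ) fun σ : Equiv.Perm ι => g (σ i) (σ j)
  have h1 : ∑ _σ : Equiv.Perm ι, ∑ k, ∑ l, g k l =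
      ∑ k, ∑ l, ∑ σ : Equiv.Perm ι, g (σ k) (σ l) := by
    rw [show ∑ k, ∑ l, ∑ σ : Equiv.Perm ι, g (σ k) (σ l) =
      ∑ σ : Equiv.Perm ι, ∑ k, ∑ l, g (σ k) (σ l) by
        rw [Finset.sum_comm]
        simp_rw [Finset.sum_comm (s := Finset.univ (α := ι)) (t := Finset.univ (α := Equiv.Perm ι))]
        refine Finset.sum_congr rfl fun σ _ => Finset.sum_comm]
    refine Finset.sum_congr rfl fun σ _ => ?_
    rw [← Equiv.sum_comp σ]
    exact Finset.sum_congr rfl fun k _ => (Equiv.sum_comp σ _).symm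
  rw [h1]
  rw [Finset.sum_congr rfl fun k _ => Finset.sum_congr rfl fun l _ => hT k l]
  simp_rw [Finset.sum_sub_distrib, Finset.sum_ite_eq, Finset.mem_univ, if_true,
    Finset.sum_const, Finset.card_univ, nsmul_eq_mul]
  ring

theorem exists_perm_sum_mul_le (a g : ι → ι → ℝ) (ha : ∀ i, a i i = 0) (hg : ∀ i, g i i = 0) :
    ∃ σ : Equiv.Perm ι, (Fintype.card ι : ℝ) * (Fintype.card ι - 1) *
      ∑ i, ∑ j, a i j * g (σ i) (σ j) ≤ (∑ i, ∑ j, a i j) * ∑ k, ∑ l, g k l := by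
  have h : ∑ σ : Equiv.Perm ι, ((Fintype.card ι : ℝ) * (Fintype.card ι - 1) *
      ∑ i, ∑ j, a i j * g (σ i) (σ j)) =
      ∑ _σ : Equiv.Perm ι, (∑ i, ∑ j, a i j) * ∑ k, ∑ l, g k l := by
    have hij : ∀ i j, ∑ σ : Equiv.Perm ι, ((Fintype.card ι : ℝ) * (Fintype.card ι - 1) *
        (a i j * g (σ i) (σ j))) = ∑ _σ : Equiv.Perm ι, a i j * ∑ k, ∑ l, g k l := by
      intro i j
      by_cases hij : i = j
      · simp [hij, ha]
      · rw [← Finset.mul_sum, ← Finset.mul_sum, ← Finset.mul_sum, ← card_mul_sum_perm_eq g hg hij]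
        ring
    calc _ = ∑ i, ∑ j, ∑ σ : Equiv.Perm ι, ((Fintype.card ι : ℝ) * (Fintype.card ι - 1) *
        (a i j * g (σ i) (σ j))) := by
          simp_rw [Finset.mul_sum]
          rw [Finset.sum_comm]
          exact Finset.sum_congr rfl fun i _ => Finset.sum_comm
      _ = ∑ i, ∑ j, ∑ _σ : Equiv.Perm ι, a i j * ∑ k, ∑ l, g k l :=
          Finset.sum_congr rfl fun i _ => Finset.sum_congr rfl fun j _ => hij i j
      _ = _ := by
          simp_rw [Finset.sum_const, ← Finset.smul_sum, Finset.sum_mul]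
  obtain ⟨σ, -, hσ⟩ := Finset.exists_le_of_sum_le Finset.univ_nonempty h.le
  exact ⟨σ, hσ⟩

end Averaging

/-! ### The upper bound -/

section UpperBound

variable {m : ℕ}

/-- The zero diagonal case: `B` is diagonal with well spaced entries, in an order for which
`‖C‖₂` does not exceed its root mean square over all orders. -/
theorem exists_commutator_of_diag_eq_zero (hm : 2 ≤ m) (A : Matrix (Fin m) (Fin m) ℂ)
    (hA : ∀ i, A i i = 0) :
    ∃ (d : Fin m → ℂ) (C : Matrix (Fin m) (Fin m) ℂ),
      A = Matrix.diagonal d * C - C * Matrix.diagonal d ∧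
        opNorm (Matrix.diagonal d) * hsNorm C ≤ Real.sqrt (500 + Real.log m) * hsNorm A := by
  obtain ⟨R, β, hR, hβ, hβR, hsum⟩ := exists_well_spaced_points hm
  obtain ⟨σ, hσ⟩ := exists_perm_sum_mul_le (fun i j => ‖A i j‖ ^ 2)
    (fun i j => (‖β i - β j‖ ^ 2)⁻¹) (by simp [hA]) (by simp)
  rw [Fintype.card_fin, ← hsNorm_sq] at hσ
  set C : Matrix (Fin m) (Fin m) ℂ := Matrix.of fun i j => A i j / (β (σ i) - β (σ j)) with hC
  refine ⟨fun i => β (σ i), C, ?_, ?_⟩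
  · ext i j
    rw [Matrix.sub_apply, Matrix.diagonal_mul, Matrix.mul_diagonal, hC, Matrix.of_apply]
    by_cases hij : i = j
    · simp [hij, hA]
    · have : β (σ i) - β (σ j) ≠ 0 := sub_ne_zero.2 fun h => hij (σ.injective (hβ h))
      field_simp
  have hm' : (2 : ℝ) ≤ m := by exact_mod_cast hm
  have hlog : 0 ≤ 500 + Real.log m := by
    have := Real.log_nonneg (show (1 : ℝ) ≤ m by linarith)
    linarith
  have hCsq : hsNorm C ^ 2 = ∑ i, ∑ j, ‖A i j‖ ^ 2 * (‖β (σ i) - β (σ j)‖ ^ 2)⁻¹ := by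
    rw [hsNorm_sq]
    refine Finset.sum_congr rfl fun i _ => Finset.sum_congr rfl fun j _ => ?_
    rw [hC, Matrix.of_apply, norm_div, div_pow, div_eq_mul_inv]
  rw [← hCsq] at hσ
  have hmm : (0 : ℝ) < m * (m - 1) := mul_pos (by linarith) (by linarith)
  have hfin : (R * hsNorm C) ^ 2 ≤ (Real.sqrt (500 + Real.log m) * hsNorm A) ^ 2 := by
    rw [mul_pow, mul_pow, Real.sq_sqrt hlog]
    refine le_of_mul_le_mul_left ?_ hmm
    calc (m : ℝ) * (m - 1) * (R ^ 2 * hsNorm C ^ 2)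
        = R ^ 2 * ((m : ℝ) * (m - 1) * hsNorm C ^ 2) := by ring
      _ ≤ R ^ 2 * (hsNorm A ^ 2 * ∑ k, ∑ l, (‖β k - β l‖ ^ 2)⁻¹) := by gcongr
      _ = (R ^ 2 * ∑ k, ∑ l, (‖β k - β l‖ ^ 2)⁻¹) * hsNorm A ^ 2 := by ring
      _ ≤ (m * (m - 1) * (500 + Real.log m)) * hsNorm A ^ 2 := by gcongr
      _ = _ := by ring
  calc _ ≤ R * hsNorm C :=
        mul_le_mul_of_nonneg_right (opNorm_diagonal_le hR fun i => hβR (σ i)) (hsNorm_nonneg C)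
    _ ≤ _ := (pow_le_pow_iff_left₀ (mul_nonneg hR (hsNorm_nonneg C))
        (mul_nonneg (Real.sqrt_nonneg _) (hsNorm_nonneg A)) two_ne_zero).1 hfin

theorem exists_normal_commutator (A : Matrix (Fin m) (Fin m) ℂ) (hA : A.trace = 0) :
    ∃ B C : Matrix (Fin m) (Fin m) ℂ, A = B * C - C * B ∧ IsStarNormal B ∧
      opNorm B * hsNorm C ≤ Real.sqrt (500 + Real.log m) * hsNorm A := by
  by_cases hm : m < 2
  · have hA0 : A = 0 := by
      ext i j
      interval_cases m
      · exact i.elim0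
      · rw [Matrix.trace_fin_one] at hA
        rw [Subsingleton.elim i 0, Subsingleton.elim j 0, hA, Matrix.zero_apply]
    refine ⟨0, 0, by simp [hA0], inferInstance, ?_⟩
    simp [opNorm, hA0, hsNorm]
  obtain ⟨U, hU, hdiag⟩ := exists_unitary_conj_diag_eq_zero A hA
  obtain ⟨d, C, hAC, hbound⟩ := exists_commutator_of_diag_eq_zero (not_lt.1 hm) _ hdiag
  have hU' : star U ∈ Matrix.unitaryGroup (Fin m) ℂ := Unitary.star_mem hU
  have h1 : U * star U = 1 := Matrix.mem_unitaryGroup_iff.1 hU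
  have h2 : star U * U = 1 := Matrix.mem_unitaryGroup_iff'.1 hU
  have hmul : ∀ X Y : Matrix (Fin m) (Fin m) ℂ,
      U * X * star U * (U * Y * star U) = U * (X * Y) * star U := by
    intro X Y
    calc U * X * star U * (U * Y * star U) = U * X * (star U * U) * Y * star U := by
          simp only [mul_assoc]
      _ = _ := by rw [h2, mul_one]; simp only [mul_assoc]
  refine ⟨U * Matrix.diagonal d * star U, U * C * star U, ?_, ⟨?_⟩, ?_⟩
  · rw [hmul, hmul, ← sub_mul, ← mul_sub, ← hAC]
    calc A = (U * star U) * A * (U * star U) := by rw [h1, one_mul, mul_one]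
      _ = _ := by simp only [mul_assoc]
  · rw [star_mul, star_mul, star_star, ← mul_assoc, Commute, SemiconjBy, hmul, hmul,
      Matrix.star_eq_conjTranspose (Matrix.diagonal d), Matrix.diagonal_conjTranspose,
      Matrix.diagonal_mul_diagonal, Matrix.diagonal_mul_diagonal]
    simp only [mul_comm]
  · have ho := opNorm_unitary_conj hU' (Matrix.diagonal d)
    have hh := hsNorm_unitary_conj hU' C
    rw [star_star] at ho hh
    rw [ho, hh]
    rwa [hsNorm_unitary_conj hU] at hbound

end UpperBound

/-! ### Block Hessenberg matrices -/

section Levels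

variable {m : ℕ}

/-- The partial trace of a commutator of block Hessenberg matrices over the levels up to `n` only
involves the blocks between the levels `n` and `n + 1`: the other terms cancel or vanish. -/
theorem sum_filter_diag_commutator_eq {B C : Matrix (Fin m) (Fin m) ℂ} {lev : Fin m → ℕ}
    (hB : ∀ i j, lev j + 1 < lev i → B i j = 0) (hC : ∀ i j, lev j + 1 < lev i → C i j = 0)
    (n : ℕ) :
    ∑ i with lev i ≤ n, (B * C - C * B) i i =
      ∑ i with lev i = n, ∑ k with lev k = n + 1, (B i k * C k i - C i k * B k i) := by
  set f : Fin m → Fin m → ℂ := fun i k => B i k * C k i - C i k * B k i with hf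
  have hanti : ∑ i with lev i ≤ n, ∑ k with lev k ≤ n, f i k = 0 := by
    have h : ∑ i with lev i ≤ n, ∑ k with lev k ≤ n, f i k =
        -∑ i with lev i ≤ n, ∑ k with lev k ≤ n, f i k := by
      conv_lhs => rw [Finset.sum_comm]
      simp only [← Finset.sum_neg_distrib]
      refine Finset.sum_congr rfl fun i _ => Finset.sum_congr rfl fun k _ => ?_
      simp only [hf]; ring
    exact self_eq_neg.1 h
  have hzero : ∀ i k, lev i + 1 < lev k → f i k = 0 := by
    intro i k h
    simp only [hf, hB k i h, hC k i h, mul_zero, sub_zero]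
  have hdiag : ∀ i, (B * C - C * B) i i =
      ∑ k with lev k ≤ n, f i k + ∑ k with ¬ lev k ≤ n, f i k := by
    intro i
    rw [Finset.sum_filter_add_sum_filter_not, Matrix.sub_apply, Matrix.mul_apply, Matrix.mul_apply,
      ← Finset.sum_sub_distrib]
  rw [Finset.sum_congr rfl fun i _ => hdiag i, Finset.sum_add_distrib, hanti, zero_add]
  symm
  refine Finset.sum_subset_zero_on_sdiff (fun i hi => ?_) (fun i hi => ?_) fun i hi => ?_
  · simp only [Finset.mem_filter, Finset.mem_univ, true_and] at hi ⊢; omega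
  · simp only [Finset.mem_sdiff, Finset.mem_filter, Finset.mem_univ, true_and] at hi
    refine Finset.sum_eq_zero fun k hk => hzero i k ?_
    simp only [Finset.mem_filter, Finset.mem_univ, true_and] at hk
    omega
  · simp only [Finset.mem_filter, Finset.mem_univ, true_and] at hi
    refine Finset.sum_subset_zero_on_sdiff (fun k hk => ?_) (fun k hk => hzero i k ?_)
      fun k _ => rfl
    · simp only [Finset.mem_filter, Finset.mem_univ, true_and] at hk ⊢; omega
    · simp only [Finset.mem_sdiff, Finset.mem_filter, Finset.mem_univ, true_and] at hk; omega

theorem sum_sum_mul_sq_le {ι : Type*} (s t : Finset ι) (x y : ι → ι → ℝ) {K : ℝ}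
    (hx : ∀ i ∈ s, ∑ k ∈ t, x i k ^ 2 ≤ K) :
    (∑ i ∈ s, ∑ k ∈ t, x i k * y i k) ^ 2 ≤ s.card * K * ∑ i ∈ s, ∑ k ∈ t, y i k ^ 2 := by
  have h := Finset.sum_mul_sq_le_sq_mul_sq (s ×ˢ t) (fun p => x p.1 p.2) (fun p => y p.1 p.2)
  rw [Finset.sum_product, Finset.sum_product, Finset.sum_product] at h
  refine h.trans (mul_le_mul_of_nonneg_right ?_ (by positivity))
  exact (Finset.sum_le_sum hx).trans_eq (by rw [Finset.sum_const, nsmul_eq_mul])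

theorem norm_sum_filter_diag_commutator_sq_le {B C : Matrix (Fin m) (Fin m) ℂ} {lev : Fin m → ℕ}
    (hB : ∀ i j, lev j + 1 < lev i → B i j = 0) (hC : ∀ i j, lev j + 1 < lev i → C i j = 0)
    (n : ℕ) :
    ‖∑ i with lev i ≤ n, (B * C - C * B) i i‖ ^ 2 ≤
      2 * (Finset.card {i | lev i = n} * opNorm B ^ 2) *
        ∑ i with lev i = n, ∑ k with lev k = n + 1, (‖C k i‖ ^ 2 + ‖C i k‖ ^ 2) := by
  rw [sum_filter_diag_commutator_eq hB hC]
  set s : Finset (Fin m) := {i | lev i = n}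
  set t : Finset (Fin m) := {k | lev k = n + 1}
  set X := ∑ i ∈ s, ∑ k ∈ t, ‖B i k‖ * ‖C k i‖ with hX
  set Y := ∑ i ∈ s, ∑ k ∈ t, ‖B k i‖ * ‖C i k‖ with hY
  have hXY : ‖∑ i ∈ s, ∑ k ∈ t, (B i k * C k i - C i k * B k i)‖ ≤ X + Y := by
    rw [hX, hY, ← Finset.sum_add_distrib]
    refine (norm_sum_le _ _).trans (Finset.sum_le_sum fun i _ => ?_)
    rw [← Finset.sum_add_distrib]
    refine (norm_sum_le _ _).trans (Finset.sum_le_sum fun k _ => ?_)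
    refine (norm_sub_le _ _).trans_eq ?_
    rw [norm_mul, norm_mul, mul_comm ‖C i k‖]
  have h1 : X ^ 2 ≤ s.card * opNorm B ^ 2 * ∑ i ∈ s, ∑ k ∈ t, ‖C k i‖ ^ 2 :=
    sum_sum_mul_sq_le s t (fun i k => ‖B i k‖) (fun i k => ‖C k i‖) fun i _ =>
      (Finset.sum_le_sum_of_subset_of_nonneg (Finset.subset_univ t) fun _ _ _ => by
        positivity).trans (sum_row_sq_le_opNorm_sq B i)
  have h2 : Y ^ 2 ≤ s.card * opNorm B ^ 2 * ∑ i ∈ s, ∑ k ∈ t, ‖C i k‖ ^ 2 :=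
    sum_sum_mul_sq_le s t (fun i k => ‖B k i‖) (fun i k => ‖C i k‖) fun i _ =>
      (Finset.sum_le_sum_of_subset_of_nonneg (Finset.subset_univ t) fun _ _ _ => by
        positivity).trans (sum_col_sq_le_opNorm_sq B i)
  calc _ ≤ (X + Y) ^ 2 := pow_le_pow_left₀ (norm_nonneg _) hXY 2
    _ ≤ 2 * (X ^ 2 + Y ^ 2) := add_sq_le
    _ ≤ 2 * (s.card * opNorm B ^ 2 * ∑ i ∈ s, ∑ k ∈ t, ‖C k i‖ ^ 2 +
          s.card * opNorm B ^ 2 * ∑ i ∈ s, ∑ k ∈ t, ‖C i k‖ ^ 2) := by gcongr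
    _ = _ := by simp only [Finset.sum_add_distrib]; ring

theorem sum_range_ite_succ_le (N p q : ℕ) {x : ℝ} (hx : 0 ≤ x) :
    (∑ n ∈ Finset.range N, if p = n ∧ q = n + 1 then x else 0) ≤ if q = p + 1 then x else 0 := by
  by_cases h : q = p + 1
  · rw [if_pos h]
    have : ∀ n ∈ Finset.range N, (if p = n ∧ q = n + 1 then x else 0) = if p = n then x else 0 :=
      fun n _ => by
        by_cases hp : p = n
        · simp [hp, h]
        · simp [hp]
    rw [Finset.sum_congr rfl this, Finset.sum_ite_eq]
    split_ifs <;> simp [hx]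
  · rw [if_neg h]
    refine (Finset.sum_eq_zero fun n _ => if_neg ?_).le
    omega

/-- The blocks of `C` between consecutive levels, below and above the diagonal, are disjoint. -/
theorem sum_consecutive_blocks_le (C : Matrix (Fin m) (Fin m) ℂ) (lev : Fin m → ℕ) (N : ℕ) :
    ∑ n ∈ Finset.range N, ∑ i with lev i = n, ∑ k with lev k = n + 1,
      (‖C k i‖ ^ 2 + ‖C i k‖ ^ 2) ≤ hsNorm C ^ 2 := by
  have hblock : ∀ x : Fin m → Fin m → ℝ, (∀ i k, 0 ≤ x i k) →
      ∑ n ∈ Finset.range N, ∑ i with lev i = n, ∑ k with lev k = n + 1, x i k ≤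
        ∑ i, ∑ k, if lev k = lev i + 1 then x i k else 0 := by
    intro x hx
    have h : ∀ n, ∑ i with lev i = n, ∑ k with lev k = n + 1, x i k =
        ∑ i, ∑ k, if lev i = n ∧ lev k = n + 1 then x i k else 0 := by
      intro n
      rw [Finset.sum_filter]
      refine Finset.sum_congr rfl fun i _ => ?_
      rw [Finset.sum_filter]
      by_cases hi : lev i = n <;> simp [hi]
    simp_rw [h]
    rw [Finset.sum_comm]
    refine Finset.sum_le_sum fun i _ => ?_
    rw [Finset.sum_comm]
    exact Finset.sum_le_sum fun k _ => sum_range_ite_succ_le N _ _ (hx i k)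
  simp_rw [Finset.sum_add_distrib]
  refine (add_le_add (hblock (fun i k => ‖C k i‖ ^ 2) fun _ _ => by positivity)
    (hblock (fun i k => ‖C i k‖ ^ 2) fun _ _ => by positivity)).trans ?_
  rw [Finset.sum_comm, ← Finset.sum_add_distrib, hsNorm_sq]
  refine Finset.sum_le_sum fun i _ => ?_
  rw [← Finset.sum_add_distrib]
  refine Finset.sum_le_sum fun k _ => ?_
  by_cases h1 : lev i = lev k + 1
  · rw [if_pos h1, if_neg (by omega), add_zero]
  · rw [if_neg h1, zero_add]
    split_ifs
    · exact le_rfl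
    · positivity

theorem card_filter_le_le {lev : Fin m → ℕ} {n : ℕ}
    (h : ∀ p ≤ n, Finset.card {i | lev i = p} ≤ p + 1) :
    2 * Finset.card {i | lev i ≤ n} ≤ (n + 1) * (n + 2) := by
  induction n with
  | zero => simpa using Nat.mul_le_mul_left 2 (h 0 le_rfl)
  | succ n ih =>
    have h1 := ih fun p hp => h p (by omega)
    have h2 := h (n + 1) le_rfl
    have h3 : (Finset.univ.filter fun i => lev i ≤ n + 1) =
        (Finset.univ.filter fun i => lev i ≤ n) ∪ Finset.univ.filter fun i => lev i = n + 1 := by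
      ext i; simp only [Finset.mem_filter, Finset.mem_union, Finset.mem_univ, true_and]; omega
    have h4 := Finset.card_union_le (Finset.univ.filter fun i => lev i ≤ n)
      (Finset.univ.filter fun i => lev i = n + 1)
    rw [h3]
    nlinarith

/-- The summand is the lower bound `(1 - 2 d / m) / (n + 1)` for `(1 - d / m)² / (n + 1)` at
`d = (n + 1) (n + 2) / 2`. -/
theorem half_log_sub_two_le {m : ℕ} (hm : 1 ≤ m) :
    Real.log m / 2 - 2 ≤
      ∑ n ∈ Finset.range (Nat.sqrt m), (((n : ℝ) + 1)⁻¹ - ((n : ℝ) + 2) / m) := by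
  set N := Nat.sqrt m with hN
  have hm' : (1 : ℝ) ≤ m := by exact_mod_cast hm
  have hN2 : (N : ℝ) ^ 2 ≤ m := by exact_mod_cast Nat.sqrt_le' m
  have hNm : (N : ℝ) ≤ m := by exact_mod_cast Nat.sqrt_le_self m
  have hlt : (m : ℝ) < ((N : ℝ) + 1) ^ 2 := by exact_mod_cast Nat.lt_succ_sqrt' m
  have hlog : Real.log m ≤ 2 * Real.log ((N : ℝ) + 1) := by
    have h := Real.log_le_log (by linarith) hlt.le
    rwa [Real.log_pow, Nat.cast_ofNat] at h
  have hharm : Real.log ((N : ℝ) + 1) ≤ ∑ n ∈ Finset.range N, ((n : ℝ) + 1)⁻¹ := by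
    have h := log_add_one_le_harmonic N
    rw [harmonic] at h
    push_cast at h
    exact h
  have hlin : ∀ K : ℕ, ∑ n ∈ Finset.range K, ((n : ℝ) + 2) = K * (K + 3) / 2 := by
    intro K
    induction K with
    | zero => simp
    | succ K ih => rw [Finset.sum_range_succ, ih]; push_cast; ring
  rw [Finset.sum_sub_distrib, ← Finset.sum_div, hlin]
  have : (N : ℝ) * (N + 3) / 2 / m ≤ 2 := by
    rw [div_le_iff₀ (by linarith)]
    nlinarith
  linarith

/-- The counting part of the lower bound. The commutator of `B` and `C` has partial traces
`1 - d / m` along the levels, `d` being the number of indices passed; both matrices are block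
Hessenberg and the `n`-th level has at most `n + 1` elements. -/
theorem log_sub_four_le_of_levels {B C : Matrix (Fin m) (Fin m) ℂ} {lev : Fin m → ℕ} (hm : 1 ≤ m)
    (hB : ∀ i j, lev j + 1 < lev i → B i j = 0) (hC : ∀ i j, lev j + 1 < lev i → C i j = 0)
    (hcard : ∀ n < Nat.sqrt m, Finset.card {i | lev i = n} ≤ n + 1)
    (htr : ∀ n, ∑ i with lev i ≤ n, (B * C - C * B) i i =
      1 - (Finset.card {i | lev i ≤ n} : ℂ) / m) :
    -4 + Real.log m ≤ (2 * (opNorm B * hsNorm C)) ^ 2 := by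
  have hm' : (0 : ℝ) < m := by exact_mod_cast hm
  have hterm : ∀ n ∈ Finset.range (Nat.sqrt m), ((n : ℝ) + 1)⁻¹ - ((n : ℝ) + 2) / m ≤
      2 * opNorm B ^ 2 *
        ∑ i with lev i = n, ∑ k with lev k = n + 1, (‖C k i‖ ^ 2 + ‖C i k‖ ^ 2) := by
    intro n hn
    rw [Finset.mem_range] at hn
    have h1 := norm_sum_filter_diag_commutator_sq_le hB hC n
    set S := ∑ i with lev i = n, ∑ k with lev k = n + 1, (‖C k i‖ ^ 2 + ‖C i k‖ ^ 2) with hS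
    have hS0 : 0 ≤ S := by positivity
    set D : ℕ := Finset.card {i | lev i ≤ n} with hD
    have hnorm : ‖(1 : ℂ) - (D : ℂ) / m‖ ^ 2 = (1 - (D : ℝ) / m) ^ 2 := by
      rw [show (1 : ℂ) - (D : ℂ) / m = ((1 - (D : ℝ) / m : ℝ) : ℂ) by push_cast; rfl,
        Complex.norm_real, Real.norm_eq_abs, sq_abs]
    rw [htr n, hnorm] at h1
    have hDle : (D : ℝ) / m * 2 ≤ ((n : ℝ) + 1) * ((n : ℝ) + 2) / m := by
      have h : 2 * D ≤ (n + 1) * (n + 2) :=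
        card_filter_le_le fun p hp => hcard p (hp.trans_lt hn)
      have h' : (2 : ℝ) * D ≤ ((n : ℝ) + 1) * ((n : ℝ) + 2) := by exact_mod_cast h
      rw [div_mul_eq_mul_div]
      exact div_le_div_of_nonneg_right (by linarith) hm'.le
    have hs : ((Finset.card {i | lev i = n} : ℕ) : ℝ) ≤ (n : ℝ) + 1 := by
      exact_mod_cast hcard n hn
    have hsq : 1 - ((n : ℝ) + 1) * ((n : ℝ) + 2) / m ≤ (1 - (D : ℝ) / m) ^ 2 := by
      nlinarith [sq_nonneg ((D : ℝ) / m)]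
    have hall : 1 - ((n : ℝ) + 1) * ((n : ℝ) + 2) / m ≤
        ((n : ℝ) + 1) * (2 * opNorm B ^ 2 * S) := by
      refine (hsq.trans h1).trans ?_
      calc _ = (Finset.card {i | lev i = n} : ℝ) * (2 * opNorm B ^ 2 * S) := by ring
        _ ≤ _ := by gcongr
    have hn1 : (0 : ℝ) < (n : ℝ) + 1 := by positivity
    calc ((n : ℝ) + 1)⁻¹ - ((n : ℝ) + 2) / m
        = (1 - ((n : ℝ) + 1) * ((n : ℝ) + 2) / m) / ((n : ℝ) + 1) := by field_simp
      _ ≤ _ := by rw [div_le_iff₀ hn1]; linarith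
  have h := (half_log_sub_two_le hm).trans (Finset.sum_le_sum hterm)
  rw [← Finset.mul_sum] at h
  have h2 := mul_le_mul_of_nonneg_left (sum_consecutive_blocks_le C lev (Nat.sqrt m))
    (show 0 ≤ 2 * opNorm B ^ 2 by positivity)
  rw [mul_pow, mul_pow]
  linarith

end Levels

/-! ### Orthonormal bases adapted to a flag -/

section Flag

variable {E : Type*} [NormedAddCommGroup E] [InnerProductSpace ℂ E] [FiniteDimensional ℂ E]

/-- A flag `⊥ = F 0 ≤ F 1 ≤ ⋯ ≤ F (N + 1) = ⊤` has an adapted orthonormal basis: each basis vector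
has a level `p` such that it lies in `F (p + 1)` and is orthogonal to `F p`. -/
theorem exists_orthonormalBasis_adapted {m N : ℕ} (hm : Module.finrank ℂ E = m)
    {F : ℕ → Submodule ℂ E} (hmono : Monotone F) (h0 : F 0 = ⊥) (hN : F (N + 1) = ⊤) :
    ∃ (b : OrthonormalBasis (Fin m) ℂ E) (lev : Fin m → ℕ), (∀ i, b i ∈ F (lev i + 1)) ∧
      (∀ i, b i ∈ (F (lev i))ᗮ) ∧ ∀ p ≤ N, Module.finrank ℂ (F p) + Finset.card {i | lev i = p} =
        Module.finrank ℂ (F (p + 1)) := by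
  set W : Fin (N + 1) → Submodule ℂ E := fun p => (F p)ᗮ ⊓ F (p + 1) with hW
  have hlt : ∀ p q : Fin (N + 1), p < q → ∀ x ∈ W p, ∀ y ∈ W q, inner ℂ x y = 0 := by
    intro p q hpq x hx y hy
    refine (Submodule.mem_orthogonal _ _).1 hy.1 x (hmono ?_ hx.2)
    exact hpq
  have horth : OrthogonalFamily ℂ (fun p => W p) fun p => (W p).subtypeₗᵢ := by
    intro p q hpq x y
    rcases lt_or_gt_of_ne hpq with h | h
    · exact hlt p q h x x.2 y y.2
    · exact inner_eq_zero_symm.1 (hlt q p h y y.2 x x.2)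
  have hsup : ∀ k ≤ N + 1, F k ≤ iSup W := by
    intro k
    induction k with
    | zero => intro _; rw [h0]; exact bot_le
    | succ k ih =>
      intro hk
      rw [← Submodule.sup_orthogonal_inf_of_hasOrthogonalProjection (hmono k.le_succ)]
      exact sup_le (ih (by omega)) (le_iSup W ⟨k, by omega⟩)
  have hint : DirectSum.IsInternal W := by
    have htop : iSup W = ⊤ := top_le_iff.1 (hN.symm.trans_le (hsup (N + 1) le_rfl))
    rw [horth.isInternal_iff, htop, Submodule.top_orthogonal_eq_bot]
  set b' := hint.collectedOrthonormalBasis horth fun p => stdOrthonormalBasis ℂ (W p) with hb'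
  have hcardι : Fintype.card (Σ p, Fin (Module.finrank ℂ (W p))) = Fintype.card (Fin m) := by
    rw [← Module.finrank_eq_card_basis b'.toBasis, hm, Fintype.card_fin]
  set e := Fintype.equivOfCardEq hcardι
  have hmem : ∀ i, b' (e.symm i) ∈ W (e.symm i).1 := fun i =>
    hint.collectedOrthonormalBasis_mem horth _ _
  refine ⟨b'.reindex e, fun i => (e.symm i).1, fun i => ?_, fun i => ?_, fun p hp => ?_⟩
  · rw [OrthonormalBasis.reindex_apply]; exact (hmem i).2
  · rw [OrthonormalBasis.reindex_apply]; exact (hmem i).1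
  · rw [← Submodule.finrank_add_inf_finrank_orthogonal (hmono p.le_succ)]
    congr 1
    set q : Fin (N + 1) := ⟨p, by omega⟩
    have hinj : Function.Injective fun k : Fin (Module.finrank ℂ (W q)) => e ⟨q, k⟩ :=
      e.injective.comp sigma_mk_injective
    have : (Finset.univ.filter fun i => ((e.symm i).1 : ℕ) = p) =
        (Finset.univ : Finset (Fin (Module.finrank ℂ (W q)))).map
          ⟨fun k => e ⟨q, k⟩, hinj⟩ := by
      ext i
      simp only [Finset.mem_filter, Finset.mem_univ, true_and, Finset.mem_map,
        Function.Embedding.coeFn_mk]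
      constructor
      · intro h
        obtain ⟨⟨p', k⟩, rfl⟩ := e.surjective i
        rw [e.symm_apply_apply] at h
        obtain rfl : p' = q := Fin.ext h
        exact ⟨k, rfl⟩
      · rintro ⟨k, rfl⟩
        exact congrArg (fun x => (x.1 : ℕ)) (e.symm_apply_apply ⟨q, k⟩)
    rw [this, Finset.card_map, Finset.card_univ, Fintype.card_fin]

end Flag

/-! ### The filtration generated by two operators -/

section Krylov

variable {E : Type*} [AddCommGroup E] [Module ℂ E]

/-- The span of the vectors `Cⁱ Bʲ e` with `i + j < n`. -/
def krylov (B C : E →ₗ[ℂ] E) (e : E) (n : ℕ) : Submodule ℂ E :=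
  Submodule.span ℂ {x | ∃ i j : ℕ, i + j < n ∧ (C ^ i) ((B ^ j) e) = x}

variable {B C : E →ₗ[ℂ] E} {e : E}

theorem pow_apply_pow_apply_mem_krylov {i j n : ℕ} (h : i + j < n) :
    (C ^ i) ((B ^ j) e) ∈ krylov B C e n :=
  Submodule.subset_span ⟨i, j, h, rfl⟩

theorem krylov_mono : Monotone (krylov B C e) := fun _ _ h =>
  Submodule.span_mono fun _ ⟨i, j, hij, hx⟩ => ⟨i, j, hij.trans_le h, hx⟩

theorem krylov_zero : krylov B C e 0 = ⊥ := by
  refine Submodule.span_eq_bot.2 ?_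
  rintro _ ⟨i, j, h, -⟩
  omega

theorem self_mem_krylov {n : ℕ} (hn : 1 ≤ n) : e ∈ krylov B C e n := by
  simpa using pow_apply_pow_apply_mem_krylov (B := B) (C := C) (e := e) (i := 0) (j := 0) hn

theorem right_apply_mem_krylov {n : ℕ} {x : E} (hx : x ∈ krylov B C e n) :
    C x ∈ krylov B C e (n + 1) := by
  suffices h : krylov B C e n ≤ (krylov B C e (n + 1)).comap C from h hx
  refine Submodule.span_le.2 ?_
  rintro _ ⟨i, j, h, rfl⟩
  have := pow_apply_pow_apply_mem_krylov (B := B) (C := C) (e := e) (i := i + 1) (j := j)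
    (n := n + 1) (by omega)
  rwa [pow_succ', Module.End.mul_apply] at this

/-- Modulo scalars and multiples of `e`, the operators `B` and `C` commute, so `B` can be moved
past the powers of `C` at the cost of vectors that occur earlier in the filtration. -/
theorem left_apply_mem_krylov {μ : ℂ} (h : ∀ y, ∃ c : ℂ, B (C y) - C (B y) = c • e - μ • y) {n : ℕ}
    {x : E} (hx : x ∈ krylov B C e n) : B x ∈ krylov B C e (n + 1) := by
  have key : ∀ i j : ℕ, B ((C ^ i) ((B ^ j) e)) ∈ krylov B C e (i + j + 2) := by
    intro i j
    induction i with
    | zero =>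
      have := pow_apply_pow_apply_mem_krylov (B := B) (C := C) (e := e) (i := 0) (j := j + 1)
        (n := 0 + j + 2) (by omega)
      rwa [pow_succ', Module.End.mul_apply] at this
    | succ i ih =>
      rw [pow_succ', Module.End.mul_apply]
      set y := (C ^ i) ((B ^ j) e) with hy
      obtain ⟨c, hc⟩ := h y
      rw [eq_add_of_sub_eq hc]
      refine Submodule.add_mem _ (Submodule.sub_mem _ (Submodule.smul_mem _ _
        (self_mem_krylov (by omega))) (Submodule.smul_mem _ _
          (pow_apply_pow_apply_mem_krylov (by omega)))) ?_
      exact krylov_mono (by omega) (right_apply_mem_krylov ih)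
  suffices h : krylov B C e n ≤ (krylov B C e (n + 1)).comap B from h hx
  refine Submodule.span_le.2 ?_
  rintro _ ⟨i, j, hij, rfl⟩
  exact krylov_mono (by omega) (key i j)

theorem finrank_krylov_succ_le [FiniteDimensional ℂ E] (n : ℕ) :
    Module.finrank ℂ (krylov B C e (n + 1)) ≤ Module.finrank ℂ (krylov B C e n) + (n + 1) := by
  set S := Submodule.span ℂ (Set.range fun i : Fin (n + 1) => (C ^ (i : ℕ)) ((B ^ (n - i)) e))
  have hle : krylov B C e (n + 1) ≤ krylov B C e n ⊔ S := by
    refine Submodule.span_le.2 ?_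
    rintro _ ⟨i, j, hij, rfl⟩
    by_cases h : i + j < n
    · exact Submodule.mem_sup_left (pow_apply_pow_apply_mem_krylov h)
    · refine Submodule.mem_sup_right (Submodule.subset_span ⟨⟨i, by omega⟩, ?_⟩)
      obtain rfl : j = n - i := by omega
      rfl
  have hS : Module.finrank ℂ S ≤ n + 1 := by
    refine (finrank_range_le_card (R := ℂ)
      (fun i : Fin (n + 1) => (C ^ (i : ℕ)) ((B ^ (n - i)) e))).trans_eq (Fintype.card_fin _)
  have h1 := Submodule.finrank_mono hle
  have h2 := Submodule.finrank_add_le_finrank_add_finrank (krylov B C e n) S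
  omega

end Krylov

/-! ### The lower bound -/

section LowerBound

variable {m : ℕ} {P : Matrix (Fin m) (Fin m) ℂ}

theorem one_le_of_rank_eq_one (hr : P.rank = 1) : 1 ≤ m := by
  have := P.rank_le_width
  omega

theorem trace_eq_one_of_isIdempotentElem (hP : IsIdempotentElem P) (hr : P.rank = 1) :
    P.trace = 1 := by
  have h : IsIdempotentElem (Matrix.toLin' P) := by
    rw [IsIdempotentElem, Module.End.mul_eq_comp, ← Matrix.toLin'_mul, hP.eq]
  have h2 := (LinearMap.isProj_range_iff_isIdempotentElem _).2 h |>.trace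
  rw [Matrix.trace_toLin'_eq] at h2
  rw [h2, ← Nat.cast_one, ← hr]
  rfl

theorem trace_sub_inv_smul_one (hP : IsIdempotentElem P) (hr : P.rank = 1) :
    (P - (m : ℂ)⁻¹ • (1 : Matrix (Fin m) (Fin m) ℂ)).trace = 0 := by
  have hm : (m : ℂ) ≠ 0 := by have := one_le_of_rank_eq_one hr; exact_mod_cast (by omega)
  rw [Matrix.trace_sub, Matrix.trace_smul, Matrix.trace_one, trace_eq_one_of_isIdempotentElem hP hr,
    Fintype.card_fin, smul_eq_mul, inv_mul_cancel₀ hm, sub_self]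

theorem hsNorm_sub_inv_smul_one_le (hP : IsStarProjection P) (hr : P.rank = 1) :
    hsNorm (P - (m : ℂ)⁻¹ • (1 : Matrix (Fin m) (Fin m) ℂ)) ≤ 1 := by
  set A := P - (m : ℂ)⁻¹ • (1 : Matrix (Fin m) (Fin m) ℂ) with hA
  have hstar : Aᴴ = A := by
    have h : Pᴴ = P := hP.isSelfAdjoint
    rw [hA, Matrix.conjTranspose_sub, Matrix.conjTranspose_smul, Matrix.conjTranspose_one, h]
    simp
  have hmul : Aᴴ * A = P - (m : ℂ)⁻¹ • P - (m : ℂ)⁻¹ • A := by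
    rw [hstar]
    conv_lhs => rw [hA, mul_sub, sub_mul, sub_mul]
    rw [hP.isIdempotentElem.eq]
    simp [hA, smul_sub]
  have htr := trace_conjTranspose_mul_self_eq A
  rw [hmul, Matrix.trace_sub, Matrix.trace_sub, Matrix.trace_smul, Matrix.trace_smul,
    trace_sub_inv_smul_one hP.isIdempotentElem hr,
    trace_eq_one_of_isIdempotentElem hP.isIdempotentElem hr] at htr
  have h : 1 - (m : ℝ)⁻¹ = hsNorm A ^ 2 := by
    have : ((1 - (m : ℝ)⁻¹ : ℝ) : ℂ) = ((hsNorm A ^ 2 : ℝ) : ℂ) := by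
      rw [← htr]; push_cast; simp
    exact_mod_cast this
  have h2 : hsNorm A ^ 2 ≤ 1 := by
    have : (0 : ℝ) ≤ (m : ℝ)⁻¹ := by positivity
    linarith
  exact (sq_le_one_iff₀ (hsNorm_nonneg A)).1 h2

theorem exists_toEuclideanCLM_eq_smul (hr : P.rank = 1) :
    ∃ e : EuclideanSpace ℂ (Fin m), ∀ x, ∃ c : ℂ,
      Matrix.toEuclideanCLM (n := Fin m) (𝕜 := ℂ) P x = c • e := by
  obtain ⟨v, -, hv⟩ := finrank_eq_one_iff'.1 hr
  refine ⟨WithLp.toLp 2 (v : Fin m → ℂ), fun x => ?_⟩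
  obtain ⟨c, hc⟩ := hv ⟨P *ᵥ x.ofLp, x.ofLp, rfl⟩
  refine ⟨c, ?_⟩
  have h := congrArg Subtype.val hc
  apply (WithLp.ofLp_injective 2)
  rw [Matrix.ofLp_toEuclideanCLM]
  exact h.symm

/-- In an orthonormal basis adapted to the filtration generated from the range of `P`, both `B` and
`C` are block Hessenberg, and the partial traces of `P` are all `1`. -/
theorem log_sub_four_le_of_commutator (hP : IsStarProjection P) (hr : P.rank = 1)
    {B C : Matrix (Fin m) (Fin m) ℂ}
    (hBC : P - (m : ℂ)⁻¹ • (1 : Matrix (Fin m) (Fin m) ℂ) = B * C - C * B) :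
    -4 + Real.log m ≤ (2 * (opNorm B * hsNorm C)) ^ 2 := by
  have hm := one_le_of_rank_eq_one hr
  obtain ⟨e, he⟩ := exists_toEuclideanCLM_eq_smul hr
  set op : Matrix (Fin m) (Fin m) ℂ → (EuclideanSpace ℂ (Fin m) →ₗ[ℂ] EuclideanSpace ℂ (Fin m)) :=
    fun D => (Matrix.toEuclideanCLM (n := Fin m) (𝕜 := ℂ) D).toLinearMap with hop
  have hcomm : ∀ y, ∃ c : ℂ, op B (op C y) - op C (op B y) = c • e - (m : ℂ)⁻¹ • y := by
    intro y
    obtain ⟨c, hc⟩ := he y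
    refine ⟨c, ?_⟩
    have h := congrArg (fun D => Matrix.toEuclideanCLM (n := Fin m) (𝕜 := ℂ) D y) hBC
    simp only [map_sub, map_mul, map_smul, map_one, sub_apply, hc,
      smul_apply, one_apply_eq_self] at h
    exact h.symm
  set N := Nat.sqrt m with hN
  -- The Krylov filtration, cut off at stage `N` and completed by the whole space.
  set F : ℕ → Submodule ℂ (EuclideanSpace ℂ (Fin m)) :=
    fun n => if n ≤ N then krylov (op B) (op C) e n else ⊤ with hF
  have hFle : ∀ n ≤ N, F n = krylov (op B) (op C) e n := fun n hn => if_pos hn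
  have hFtop : ∀ n, N < n → F n = ⊤ := fun n hn => if_neg (by omega)
  have hmono : Monotone F := by
    intro p q hpq
    by_cases hq : q ≤ N
    · rw [hFle p (hpq.trans hq), hFle q hq]; exact krylov_mono hpq
    · rw [hFtop q (by omega)]; exact le_top
  have hmap : ∀ D, (∀ n x, x ∈ krylov (op B) (op C) e n → op D x ∈ krylov (op B) (op C) e (n + 1)) →
      ∀ n x, x ∈ F n → op D x ∈ F (n + 1) := by
    intro D hD n x hx
    by_cases hn : n + 1 ≤ N
    · rw [hFle n (by omega)] at hx
      rw [hFle _ hn]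
      exact hD n x hx
    · rw [hFtop _ (by omega)]; trivial
  obtain ⟨b, lev, hb1, hb2, hcard⟩ := exists_orthonormalBasis_adapted (m := m) (N := N) (by simp)
    hmono (by rw [hFle 0 (Nat.zero_le _), krylov_zero]) (hFtop _ N.lt_succ_self)
  set U := basisMatrix b with hU
  have hUmem : U ∈ Matrix.unitaryGroup (Fin m) ℂ := basisMatrix_mem_unitaryGroup b
  have hentry : ∀ D i j, (star U * D * U) i j = inner ℂ (b i) (op D (b j)) :=
    fun D i j => star_basisMatrix_mul_mul_apply b D i j
  have hband : ∀ D, (∀ n x, x ∈ F n → op D x ∈ F (n + 1)) →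
      ∀ i j, lev j + 1 < lev i → (star U * D * U) i j = 0 := by
    intro D hD i j hij
    rw [hentry]
    exact inner_eq_zero_symm.1 ((Submodule.mem_orthogonal _ _).1 (hb2 i) _
      (hmono hij (hD _ _ (hb1 j))))
  have hmul : ∀ X Y, star U * X * U * (star U * Y * U) = star U * (X * Y) * U := by
    intro X Y
    calc star U * X * U * (star U * Y * U) = star U * X * (U * star U) * Y * U := by
          simp only [mul_assoc]
      _ = _ := by rw [Matrix.mem_unitaryGroup_iff.1 hUmem, mul_one]; simp only [mul_assoc]
  have hcomm' : star U * B * U * (star U * C * U) - star U * C * U * (star U * B * U) =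
      star U * P * U - (m : ℂ)⁻¹ • (1 : Matrix (Fin m) (Fin m) ℂ) := by
    rw [hmul, hmul, ← sub_mul, ← mul_sub, ← hBC, mul_sub, sub_mul, Matrix.mul_smul, mul_one,
      Matrix.smul_mul, Matrix.mem_unitaryGroup_iff'.1 hUmem]
  have hcard' : ∀ n < N, Finset.card {i | lev i = n} ≤ n + 1 := by
    intro n hn
    have h1 := hcard n hn.le
    rw [hFle n hn.le, hFle (n + 1) hn] at h1
    have h2 := finrank_krylov_succ_le (B := op B) (C := op C) (e := e) n
    omega
  rcases Nat.eq_zero_or_pos N with hN0 | hNpos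
  · exact absurd (Nat.sqrt_pos.2 hm) (by omega)
  -- The range of `P` is spanned by `e`, which is in the first stage of the filtration.
  have hPdiag : ∀ i, 0 < lev i → (star U * P * U) i i = 0 := by
    intro i hi
    rw [hentry]
    obtain ⟨c, hc⟩ := he (b i)
    have hc' : op P (b i) = c • e := hc
    rw [hc', inner_smul_right]
    have hmem : e ∈ F (lev i) := by
      refine hmono (show 1 ≤ lev i from hi) ?_
      rw [hFle 1 hNpos]
      exact self_mem_krylov le_rfl
    rw [inner_eq_zero_symm.1 ((Submodule.mem_orthogonal _ _).1 (hb2 i) e hmem), mul_zero]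
  have htr : ∀ n, ∑ i with lev i ≤ n,
      (star U * B * U * (star U * C * U) - star U * C * U * (star U * B * U)) i i =
        1 - (Finset.card {i | lev i ≤ n} : ℂ) / m := by
    intro n
    have h1 : ∑ i with lev i ≤ n, (star U * P * U) i i = 1 := by
      rw [← trace_eq_one_of_isIdempotentElem hP.isIdempotentElem hr,
        ← trace_star_mul_mul_of_mem_unitaryGroup hUmem P]
      refine Finset.sum_subset (Finset.subset_univ _) fun i _ hi => hPdiag i ?_
      simp only [Finset.mem_filter, Finset.mem_univ, true_and] at hi
      omega
    rw [hcomm']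
    simp only [Matrix.sub_apply, Finset.sum_sub_distrib, h1, Matrix.smul_apply, Matrix.one_apply_eq,
      Finset.sum_const, nsmul_eq_mul, smul_eq_mul, mul_one, div_eq_mul_inv]
  have h := log_sub_four_le_of_levels hm
    (hband B (hmap B fun n x hx => left_apply_mem_krylov hcomm hx))
    (hband C (hmap C fun n x hx => right_apply_mem_krylov hx)) hcard' htr
  rwa [opNorm_unitary_conj hUmem, hsNorm_unitary_conj hUmem] at h

theorem half_sqrt_mul_hsNorm_le (hP : IsStarProjection P) (hr : P.rank = 1)
    {B C : Matrix (Fin m) (Fin m) ℂ}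
    (hBC : P - (m : ℂ)⁻¹ • (1 : Matrix (Fin m) (Fin m) ℂ) = B * C - C * B) :
    1 / 2 * Real.sqrt (-4 + Real.log m) *
      hsNorm (P - (m : ℂ)⁻¹ • (1 : Matrix (Fin m) (Fin m) ℂ)) ≤ opNorm B * hsNorm C := by
  have h0 : 0 ≤ opNorm B * hsNorm C := mul_nonneg (opNorm_nonneg B) (hsNorm_nonneg C)
  have h1 : Real.sqrt (-4 + Real.log m) ≤ 2 * (opNorm B * hsNorm C) :=
    Real.sqrt_le_iff.2 ⟨by positivity, log_sub_four_le_of_commutator hP hr hBC⟩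
  have h2 := hsNorm_sub_inv_smul_one_le hP hr
  calc _ ≤ 1 / 2 * (2 * (opNorm B * hsNorm C)) * 1 := by
        gcongr
        exact hsNorm_nonneg _
    _ = _ := by ring

theorem isStarProjection_single (i : Fin m) :
    IsStarProjection (Matrix.single i i (1 : ℂ)) where
  isIdempotentElem := by simp [IsIdempotentElem]
  isSelfAdjoint := by simp [IsSelfAdjoint, Matrix.star_eq_conjTranspose]

theorem rank_single_self (i : Fin m) : (Matrix.single i i (1 : ℂ)).rank = 1 := by
  rw [← Matrix.diagonal_single, Matrix.rank_diagonal]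
  simp [Pi.single_apply]

end LowerBound

theorem theorem1 :
    (∃ c : ℝ, ∀ (m : ℕ) (A : Matrix (Fin m) (Fin m) ℂ), A.trace = 0 →
      ∃ B C : Matrix (Fin m) (Fin m) ℂ,
        A = B * C - C * B ∧ IsStarNormal B ∧
          opNorm B * hsNorm C ≤ Real.sqrt (c + Real.log m) * hsNorm A) ∧
    (∃ c' : ℝ,
      (∀ (m : ℕ), ∃ A : Matrix (Fin m) (Fin m) ℂ, A.trace = 0 ∧ (2 ≤ m → A ≠ 0) ∧
        ∀ B C : Matrix (Fin m) (Fin m) ℂ, A = B * C - C * B →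
          1 / 2 * Real.sqrt (c' + Real.log m) * hsNorm A ≤ opNorm B * hsNorm C) ∧
      (∀ (m : ℕ) (P : Matrix (Fin m) (Fin m) ℂ), IsStarProjection P → P.rank = 1 →
        (P - (m : ℂ)⁻¹ • (1 : Matrix (Fin m) (Fin m) ℂ)).trace = 0 ∧
        ∀ B C : Matrix (Fin m) (Fin m) ℂ,
          P - (m : ℂ)⁻¹ • (1 : Matrix (Fin m) (Fin m) ℂ) = B * C - C * B →
          1 / 2 * Real.sqrt (c' + Real.log m) *
              hsNorm (P - (m : ℂ)⁻¹ • (1 : Matrix (Fin m) (Fin m) ℂ)) ≤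
            opNorm B * hsNorm C)) := by
  refine ⟨⟨500, fun m A hA => exists_normal_commutator A hA⟩, -4, fun m => ?_, fun m P hP hr =>
    ⟨trace_sub_inv_smul_one hP.isIdempotentElem hr, fun B C h => half_sqrt_mul_hsNorm_le hP hr h⟩⟩
  rcases Nat.eq_zero_or_pos m with rfl | hm
  · refine ⟨0, Matrix.trace_zero _ _, fun h => absurd h (by norm_num), fun B C _ => ?_⟩
    simp [hsNorm]
  · set i : Fin m := ⟨0, hm⟩
    have hP := isStarProjection_single i
    have hr := rank_single_self i
    refine ⟨_, trace_sub_inv_smul_one hP.isIdempotentElem hr, fun h2 h => ?_,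
      fun B C h => half_sqrt_mul_hsNorm_le hP hr h⟩
    -- The entry in position `(1, 1)` is `-1 / m`.
    have h11 := congrFun (congrFun h ⟨1, h2⟩) ⟨1, h2⟩
    have hm0 : (m : ℂ) ≠ 0 := by exact_mod_cast hm.ne'
    simp [i, hm0] at h11
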